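/- Let $\mathbb{K}$ be a field, $q\in\mathbb{K}$, and let $V$ be a $\mathbb{K}$-vector space. **The bialgebra $\mathrm{Tridend}_q(V)$.** Let $T_n$ be the set of planar rooted trees with $n+1$ leaves all of whose internal vertices have at least two children; $T_0=\{|\}$. The free $q$-tridendriform algebra over $V$ is $\mathrm{Tridend}_q(V)=\bigoplus_{n\ge1}\mathbb{K}[T_n]\otimes V^{\otimes n}$; if $\mathcal B$ is a basis of $V$, it has the basis $\bigcup_{n\geq 1}T_n\times\mathcal B^n$ of trees whose $n$ gaps between consecutive children are decorated, from left to right, by elements of $\mathcal B$. Every decorated tree other than $|$ is uniquely $\bigvee_{w_1,\dots,w_s}(t^0,\dots,t^s)$ with $s\ge1$, where $t^0,\dots,t^s$ are the subtrees at the root and $w_1,\dots,w_s$ decorate the gaps between them. Adjoin the unit $1=|$ and define bilinear products on decorated trees recursively by: $*\,=\,\prec+\,q\,\cdot+\succ$, $1$ is a unit for $*$, $1\succ t=t=t\prec 1$, $t\succ 1=t\cdot 1=1\cdot t=1\prec t=0$ for $t\ne 1$, and, for $t=\bigvee_{v_1,\dots,v_r}(t^0,\dots,t^r)$ and $w=\bigvee_{w_1,\dots,w_s}(w^0,\dots,w^s)$,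 $$t\prec w=\bigvee(t^0,\dots,t^{r-1},t^r*w),\quad t\cdot w=\bigvee(t^0,\dots,t^{r-1},t^r*w^0,w^1,\dots,w^s),\quad t\succ w=\bigvee(t*w^0,w^1,\dots,w^s),$$ with decorations kept in place. The coproduct is given by $\Delta(1)=1\otimes1$ and $$\Delta(x)=\sum (x^0_{(1)}*\cdots*x^s_{(1)})\otimes\bigvee_{w_1,\dots,w_s}(x^0_{(2)},\dots,x^s_{(2)})+x\otimes 1\qquad\text{for }x=\bigvee_{w_1,\dots,w_s}(x^0,\dots,x^s).$$ Let $\mathrm{Prim}=\{x:\Delta(x)=x\otimes1+1\otimes x\}$ be the space of primitive elements. Put $\tilde\succ\,=q\,\cdot+\succ$ and, for $n\ge0$, $$M_{1n}(x;y_1,\dots,y_n)=\sum_{i=0}^n(-1)^{n-i}\,\omega_\prec(y_1,\dots,y_i)\,\tilde\succ\, x\prec\omega_{\tilde\succ}(y_{i+1},\dots,y_n),$$ where $\omega_\prec(y_1,\dots,y_i)=y_1\prec(y_2\prec\cdots(y_{i-1}\prec y_i))$, $\omega_{\tilde\succ}(y_{i+1},\dots,y_n)=((y_{i+1}\,\tilde\succ\,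 y_{i+2})\,\tilde\succ\cdots)\,\tilde\succ\, y_n$ and $\omega_\prec(\emptyset)=\omega_{\tilde\succ}(\emptyset)=1$. **$\mathrm{GV}_q$ algebras.** A $\mathrm{GV}_q$ algebra is a vector space $A$ with an associative bilinear product $\cdot$ and multilinear operations $M_{1n}:A\otimes A^{\otimes n}\to A$, $n\ge0$, such that $M_{10}=\mathrm{Id}$, $$M_{1m}(M_{1n}(x;y_1,\dots,y_n);z_1,\dots,z_m)=\sum_{0\le i_1\le j_1\le\dots\le i_n\le j_n\le m}M_{1r}(x;z_1,\dots,z_{i_1},M_{1l_1}(y_1;z_{i_1+1},\dots,z_{j_1}),\dots,M_{1l_n}(y_n;z_{i_n+1},\dots,z_{j_n}),z_{j_n+1},\dots,z_m),$$ with $l_k=j_k-i_k$ and $r=n+m-\sum_k l_k$, and $$M_{1n}(x\cdot y;z_1,\dots,z_n)=\sum_{0\le i\le j\le n}q^{j-i}M_{1i}(x;z_1,\dots,z_i)\cdot z_{i+1}\cdot\ldots\cdot z_j\cdot M_{1(n-j)}(y;z_{j+1},\dots,z_n).$$ A $\mathrm{GV}_q$ algebra $A$ with a linear map $V\to A$ is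 the free $\mathrm{GV}_q$ algebra over $V$ if every linear map from $V$ to a $\mathrm{GV}_q$ algebra $B$ extends uniquely to a linear map $A\to B$ compatible with the product and all the operations $M_{1n}$. **Proposition.** The subspace $\mathrm{Prim}$ of primitive elements of $\mathrm{Tridend}_q(V)$ contains $V=\mathbb{K}[T_1]\otimes V$, and is closed under the product $\cdot$ and the operations $M_{1n}$. With the product $\cdot$ and the brace operations $(-1)^nM_{1n}$, it is the free $\mathrm{GV}_q$ algebra over $V$. Equivalently, with the product $\cdot$ and the brace operations $M_{1n}$, it is the free $\mathrm{GV}_{-q}$ algebra over $V$. -/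

import Mathlib

open scoped TensorProduct

universe u w

noncomputable section

namespace Tridend

/-! ### Planar rooted trees decorated by a set

A tree with `n + 1` leaves in which every internal vertex has at least two children has `n` gaps
(pairs of consecutive children of a common vertex), ordered from left to right; each gap is
decorated by an element of `X`.  So the decorated trees with `n + 1` leaves form `T_n × X^n`. -/

mutual

/-- `leaf` is the tree `|`; `node t⁰ [(w₁, t¹), …, (w_s, t^s)]` (with `s ≥ 1`) is the tree
`⋁_{w₁, …, w_s} (t⁰, t¹, …, t^s)` obtained by joining the roots of `t⁰, …, t^s` to a new root,
the gap between `t^{i-1}` and `t^i` being decorated by `w_i`. -/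
inductive PTree (X : Type u) : Type u
  | leaf : PTree X
  | node (t : PTree X) (bs : Branches X) : PTree X

/-- Non-empty lists of pairs (decoration of the gap on the left, child). -/
inductive Branches (X : Type u) : Type u
  | single (x : X) (t : PTree X) : Branches X
  | cons (x : X) (t : PTree X) (bs : Branches X) : Branches X

end

/-- Concatenation of lists of branches. -/
def Branches.append {X : Type*} : Branches X → Branches X → Branches X
  | .single x t, cs => .cons x t cs
  | .cons x t bs, cs => .cons x t (bs.append cs)

/-- The tree with one internal vertex and two leaves, whose only gap is decorated by `x`. -/
def PTree.gen {X : Type*} (x : X) : PTree X := .node .leaf (.single x .leaf)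

/-- `Plus K X` is `Tridend_q(V)_+ = K ⊕ ⨁_{n ≥ 1} K[T_n] ⊗ V^{⊗ n}` for a vector space `V` with
basis `X`, written in its basis of decorated trees.  The tree `|` is the unit `1`; the other
trees span `Tridend_q(V)`. -/
abbrev Plus (K : Type*) [CommRing K] (X : Type*) : Type _ := PTree X →₀ K

section Products

variable {K : Type*} [CommRing K] {X : Type*} (q : K)

/-! For `t = ⋁(t⁰, …, t^r)` and `w = ⋁(w⁰, …, w^l)`:
`t ≺ w = ⋁(t⁰, …, t^{r-1}, t^r * w)`,
`t · w = ⋁(t⁰, …, t^{r-1}, t^r * w⁰, w¹, …, w^l)`,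
`t ≻ w = ⋁(t * w⁰, w¹, …, w^l)`,
where `* = ≺ + q · + ≻`, and `|` is a unit of `*`, with
`| ≻ t = t = t ≺ |` and `t ≻ | = t · | = | · t = | ≺ t = 0`.
The expressions `| ≺ |`, `| · |`, `| ≻ |` have no meaning; they are given the value `0`. -/

mutual

/-- The product `*` of two trees. -/
def starT : PTree X → PTree X → Plus K X
  | .leaf, w => Finsupp.single w 1
  | .node t bs, .leaf => Finsupp.single (.node t bs) 1
  | .node t bs, .node w ws =>
      precT (.node t bs) (.node w ws) + q • dotT (.node t bs) (.node w ws)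
        + succT (.node t bs) (.node w ws)
termination_by t w => (sizeOf t + sizeOf w, 1)

/-- The product `≺` of two trees. -/
def precT : PTree X → PTree X → Plus K X
  | .leaf, _ => 0
  | .node t bs, w => Finsupp.mapDomain (fun cs => PTree.node t cs) (starLastT bs w)
termination_by t w => (sizeOf t + sizeOf w, 0)

/-- The product `·` of two trees. -/
def dotT : PTree X → PTree X → Plus K X
  | .leaf, _ => 0
  | .node _ _, .leaf => 0
  | .node t bs, .node w ws =>
      Finsupp.mapDomain (fun cs => PTree.node t (cs.append ws)) (starLastT bs w)
termination_by t w => (sizeOf t + sizeOf w, 0)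

/-- The product `≻` of two trees. -/
def succT : PTree X → PTree X → Plus K X
  | _, .leaf => 0
  | t, .node w ws => Finsupp.mapDomain (fun u => PTree.node u ws) (starT t w)
termination_by t w => (sizeOf t + sizeOf w, 0)

/-- The last child `t^r` in a list of branches is replaced by `t^r * w`. -/
def starLastT : Branches X → PTree X → (Branches X →₀ K)
  | .single x t, w => Finsupp.mapDomain (fun u => Branches.single x u) (starT t w)
  | .cons x t bs, w => Finsupp.mapDomain (fun cs => Branches.cons x t cs) (starLastT bs w)
termination_by bs w => (sizeOf bs + sizeOf w, 0)

end

/-- The bilinear map with given values on pairs of basis elements. -/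
def bilin {Y Z W : Type*} (f : Y → Z → (W →₀ K)) : (Y →₀ K) →ₗ[K] (Z →₀ K) →ₗ[K] (W →₀ K) :=
  Finsupp.lift _ K _ fun y => Finsupp.lift _ K _ fun z => f y z

/-- The bilinear product `*`. -/
def starProd : Plus K X →ₗ[K] Plus K X →ₗ[K] Plus K X := bilin (starT q)

/-- The bilinear product `≺`. -/
def prec : Plus K X →ₗ[K] Plus K X →ₗ[K] Plus K X := bilin (precT q)

/-- The bilinear product `·`. -/
def dot : Plus K X →ₗ[K] Plus K X →ₗ[K] Plus K X := bilin (dotT q)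

/-- The bilinear product `≻`. -/
def succ : Plus K X →ₗ[K] Plus K X →ₗ[K] Plus K X := bilin (succT q)

/-- The bilinear product `q · + ≻`. -/
def succTilde : Plus K X →ₗ[K] Plus K X →ₗ[K] Plus K X := q • dot q + succ q

/-- The unit `1 = |` of `Tridend_q(V)_+`. -/
def one : Plus K X := Finsupp.single .leaf 1

/-! ### The coproduct

`Δ(|) = | ⊗ |` and, for `x = ⋁_{w₁, …, w_s}(x⁰, …, x^s)`,
`Δ(x) = ∑ (x⁰₍₁₎ * ⋯ * x^s₍₁₎) ⊗ ⋁_{w₁, …, w_s}(x⁰₍₂₎, …, x^s₍₂₎) + x ⊗ 1`. -/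

/-- `(a ⊗ c) ⊗ (b ⊗ d) ↦ (a * b) ⊗ f (c, d)`. -/
def combine {Z W : Type*} (f : PTree X → Z → W) :
    (Plus K X ⊗[K] Plus K X) ⊗[K] (Plus K X ⊗[K] (Z →₀ K)) →ₗ[K] Plus K X ⊗[K] (W →₀ K) :=
  TensorProduct.map (TensorProduct.lift (starProd q))
      (TensorProduct.lift (bilin fun t z => Finsupp.single (f t z) 1))
    ∘ₗ (TensorProduct.tensorTensorTensorComm K (Plus K X) (Plus K X) (Plus K X) (Z →₀ K)).toLinearMap

mutual

/-- The coproduct of a tree. -/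
def deltaT : PTree X → Plus K X ⊗[K] Plus K X
  | .leaf => one ⊗ₜ[K] one
  | .node t bs =>
      combine q PTree.node (deltaT t ⊗ₜ[K] deltaB bs)
        + Finsupp.single (PTree.node t bs) 1 ⊗ₜ[K] one

/-- For `bs = [(w₁, x¹), …, (w_s, x^s)]`, this is
`∑ (x¹₍₁₎ * ⋯ * x^s₍₁₎) ⊗ [(w₁, x¹₍₂₎), …, (w_s, x^s₍₂₎)]`. -/
def deltaB : Branches X → Plus K X ⊗[K] (Branches X →₀ K)
  | .single x t =>
      TensorProduct.map LinearMap.id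
        (Finsupp.lmapDomain K K fun u => Branches.single x u) (deltaT t)
  | .cons x t bs => combine q (fun u cs => Branches.cons x u cs) (deltaT t ⊗ₜ[K] deltaB bs)

end

/-- The coproduct `Δ`. -/
def delta : Plus K X →ₗ[K] Plus K X ⊗[K] Plus K X := Finsupp.lift _ K _ (deltaT q)

variable (X)

/-- The subspace of primitive elements, `Δ(x) = x ⊗ 1 + 1 ⊗ x`. -/
def Prim : Submodule K (Plus K X) where
  carrier := {x | delta q x = x ⊗ₜ[K] one + one ⊗ₜ[K] x}
  zero_mem' := by simp
  add_mem' := by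
    intro x y hx hy
    have hx' : delta q x = x ⊗ₜ[K] one + one ⊗ₜ[K] x := hx
    have hy' : delta q y = y ⊗ₜ[K] one + one ⊗ₜ[K] y := hy
    change delta q (x + y) = (x + y) ⊗ₜ[K] one + one ⊗ₜ[K] (x + y)
    rw [map_add, hx', hy', TensorProduct.add_tmul, TensorProduct.tmul_add]
    abel
  smul_mem' := by
    intro c x hx
    have hx' : delta q x = x ⊗ₜ[K] one + one ⊗ₜ[K] x := hx
    change delta q (c • x) = (c • x) ⊗ₜ[K] one + one ⊗ₜ[K] (c • x)
    rw [map_smul, hx', smul_add, TensorProduct.smul_tmul', TensorProduct.tmul_smul]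

variable {X}

/-! ### The brace operations -/

/-- `ω_≺(y₁, …, yᵢ) = y₁ ≺ (y₂ ≺ (⋯ (y_{i-1} ≺ yᵢ)))`, and `ω_≺(∅) = 1` (recall `y ≺ 1 = y`). -/
def omegaPrec (ys : List (Plus K X)) : Plus K X := ys.foldr (fun y a => prec q y a) one

/-- `ω_≻(y₁, …, yᵢ) = ((y₁ ≻ y₂) ≻ ⋯) ≻ yᵢ` for the product `≻` replaced by `q · + ≻`, and
`ω_≻(∅) = 1` (recall `1 ≻ y = y` and `1 · y = 0`). -/
def omegaSucc (ys : List (Plus K X)) : Plus K X := ys.foldl (fun a y => succTilde q a y) one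

/-- The operation
`M_{1n}(x; y₁, …, yₙ) = ∑_{i=0}^n (-1)^{n-i} ω_≺(y₁, …, yᵢ) ≻ x ≺ ω_≻(y_{i+1}, …, yₙ)`,
where `≻` stands for `q · + ≻`. -/
def braceOp (x : Plus K X) (ys : List (Plus K X)) : Plus K X :=
  ∑ i ∈ Finset.range (ys.length + 1),
    (-1 : K) ^ (ys.length - i) •
      prec q (succTilde q (omegaPrec q (ys.take i)) x) (omegaSucc q (ys.drop i))

end Products

end Tridend

/-! ### Gerstenhaber–Voronov algebras -/

/-- For `ys = [y₁, …, yₙ]`, `zs = [z₁, …, zₘ]` and `acc = []` this is the sum, over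
`0 ≤ i₁ ≤ j₁ ≤ i₂ ≤ j₂ ≤ ⋯ ≤ iₙ ≤ jₙ ≤ m`, of
`M(x; z₁, …, z_{i₁}, M(y₁; z_{i₁+1}, …, z_{j₁}), z_{j₁+1}, …, z_{iₙ}, M(yₙ; z_{iₙ+1}, …, z_{jₙ}),
z_{jₙ+1}, …, zₘ)`.
The list `acc` holds the arguments that have already been produced. -/
def braceSum {A : Type*} [AddCommMonoid A] (M : A → List A → A) (x : A) :
    (acc ys zs : List A) → A
  | acc, [], zs => M x (acc ++ zs)
  | acc, y :: ys, zs =>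
      ∑ i ∈ Finset.range (zs.length + 1), ∑ j ∈ Finset.Icc i zs.length,
        braceSum M x (acc ++ zs.take i ++ [M y ((zs.take j).drop i)]) ys (zs.drop j)

/-- A structure of `GV_q` algebra on the vector space `A`: an associative product `mul` and
operations `brace x [y₁, …, yₙ] = M_{1n}(x; y₁, …, yₙ)`, `n ≥ 0`, linear in each of the `n + 1`
arguments, satisfying the relations of a brace algebra and the distributive relation. -/
structure GVAlgebra {K : Type*} [CommRing K] (q : K) (A : Type*) [AddCommGroup A] [Module K A] where
  mul : A →ₗ[K] A →ₗ[K] A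
  mul_assoc : ∀ x y z, mul (mul x y) z = mul x (mul y z)
  brace : A → List A → A
  brace_add_left : ∀ x x' ys, brace (x + x') ys = brace x ys + brace x' ys
  brace_smul_left : ∀ (c : K) x ys, brace (c • x) ys = c • brace x ys
  brace_add : ∀ x ys y y' zs,
    brace x (ys ++ (y + y') :: zs) = brace x (ys ++ y :: zs) + brace x (ys ++ y' :: zs)
  brace_smul : ∀ (c : K) x ys y zs,
    brace x (ys ++ (c • y) :: zs) = c • brace x (ys ++ y :: zs)
  brace_nil : ∀ x, brace x [] = x
  brace_brace : ∀ x ys zs, brace (brace x ys) zs = braceSum brace x [] ys zs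
  /-- `M(x · y; z₁, …, zₙ) =
  ∑_{0 ≤ i ≤ j ≤ n} q^{j-i} M(x; z₁, …, zᵢ) · z_{i+1} · ⋯ · z_j · M(y; z_{j+1}, …, zₙ)`. -/
  brace_mul : ∀ x y zs, brace (mul x y) zs =
    ∑ i ∈ Finset.range (zs.length + 1), ∑ j ∈ Finset.Icc i zs.length,
      q ^ (j - i) • mul (brace x (zs.take i))
        (((zs.take j).drop i).foldr (fun z a => mul z a) (brace y (zs.drop j)))

namespace GVAlgebra

variable {K : Type*} [CommRing K] {q : K} {A : Type*} [AddCommGroup A] [Module K A]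

/-- The linear map `g` is a homomorphism of `GV_q` algebras. -/
def IsHom (S : GVAlgebra q A) {B : Type*} [AddCommGroup B] [Module K B] (T : GVAlgebra q B)
    (g : A →ₗ[K] B) : Prop :=
  (∀ x y, g (S.mul x y) = T.mul (g x) (g y)) ∧
    ∀ x ys, g (S.brace x ys) = T.brace (g x) (ys.map g)

/-- `A`, with the linear map `j : V → A`, is the free `GV_q` algebra over the vector space `V`:
every linear map from `V` to a `GV_q` algebra extends uniquely to a homomorphism from `A`. -/
def IsFree (S : GVAlgebra q A) {V : Type*} [AddCommGroup V] [Module K V]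
    (j : V →ₗ[K] A) : Prop :=
  ∀ (B : Type w) [AddCommGroup B] [Module K B] (T : GVAlgebra q B) (f : V →ₗ[K] B),
    ∃! g : A →ₗ[K] B, S.IsHom T g ∧ g ∘ₗ j = f

end GVAlgebra

end

/-!
The products `≺` and `≻̃ = q · + ≻` make `Tridend_q(V)_+` a dendriform algebra with `a * b = a ≺ b + a ≻̃ b`
outside the line of the unit. All computations rest on the identity (`succTilde_omegaPrec`)

`ω_≺(y₁, …, yₙ) ≻̃ x = ∑ᵢ M(x; y₁, …, yᵢ) ≺ ω_≺(y_{i+1}, …, yₙ)`,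

which holds because `ω_≺` and `ω_≻̃` are convolution inverse to each other up to signs, and which
determines the brace operations recursively. By induction on the number of arguments it yields:

* `M(x; y₁, …, yₙ)` is primitive if `x, y₁, …, yₙ` are (`braceOp_mem_Prim`), on comparing the coproducts
  of both sides;
* the brace relation (`primBrace_primBrace`), from `ω_≺(z) ≻̃ (ω_≺(y) ≻̃ x) = (ω_≺(z) * ω_≺(y)) ≻̃ x`; here `*`
  is expressed by the product of words of a brace algebra, which is compatible with
  deconcatenation (`braceWord_deconcatenation`);
* the distributive relation with parameter `-q` (`primBrace_primMul`), from
  `ω_≺(z) ≻̃ (x · y) = (ω_≺(z) ≻̃ x) · y`.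

The version with parameter `q` is obtained by multiplying `M_{1n}` by `(-1)ⁿ` (`GVAlgebra.twist`).

For freeness, the relations of a `GV_q` algebra reduce every expression in generators `x` to normal
forms `M(x₁; …) · ⋯ · M(x_s; …)` with normal forms as the remaining arguments, so an algebra in which
the normal forms are a basis is free (`GVAlgebra.isFree_of_basis`). Normal forms are indexed by the
lists of branches `[(x₁, t¹), …, (x_s, t^s)]`, and lists of normal forms by trees, a tree being the list
of the branches along its leftmost path. The elements `ω_≺(y₁, …, yₙ)`, for lists of normal forms
`y₁, …, yₙ`, span `Tridend_q(V)_+` since their span is closed under the three products. They are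
homogeneous for the grading by the multiset of decorations, whose components are finite-dimensional,
and they are indexed by the basis of trees in a way that preserves degrees; hence they are a basis
(`omegaBasis`). On this basis the coproduct is deconcatenation, so that the primitive elements have the
normal forms as a basis (`primBasis`).
-/

noncomputable section

namespace Tridend

/-! ### Linear extension of the tree operations -/

section Linear

variable {K : Type*} [CommRing K] {X : Type*}

theorem bilin_single {Y Z W : Type*} (f : Y → Z → (W →₀ K)) (y : Y) (z : Z) :
    bilin f (Finsupp.single y 1) (Finsupp.single z 1) = f y z := by
  simp [bilin]

/-- Induction on a vector of a free module, by linearity from the basis. -/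
@[elab_as_elim]
theorem basis_induction {Y : Type*} {P : (Y →₀ K) → Prop} (a : Y →₀ K) (h0 : P 0)
    (hadd : ∀ a b, P a → P b → P (a + b)) (hsmul : ∀ (c : K) a, P a → P (c • a))
    (hs : ∀ y, P (Finsupp.single y 1)) : P a := by
  induction a using Finsupp.induction_linear with
  | zero => exact h0
  | add f g hf hg => exact hadd _ _ hf hg
  | single y c =>
    have := hsmul c _ (hs y)
    simpa using this

/-- A generalized associativity law need only be checked on basis elements. -/
theorem assoc_of_single {A B C : Type*} {P Q D : Type*} [AddCommGroup P] [Module K P]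
    [AddCommGroup Q] [Module K Q] [AddCommGroup D] [Module K D]
    (f₁ : P →ₗ[K] (C →₀ K) →ₗ[K] D) (f₂ : (A →₀ K) →ₗ[K] (B →₀ K) →ₗ[K] P)
    (f₃ : (A →₀ K) →ₗ[K] Q →ₗ[K] D) (f₄ : (B →₀ K) →ₗ[K] (C →₀ K) →ₗ[K] Q)
    (h : ∀ a b c, f₁ (f₂ (Finsupp.single a 1) (Finsupp.single b 1)) (Finsupp.single c 1) =
      f₃ (Finsupp.single a 1) (f₄ (Finsupp.single b 1) (Finsupp.single c 1)))
    (a : A →₀ K) (b : B →₀ K) (c : C →₀ K) : f₁ (f₂ a b) c = f₃ a (f₄ b c) := by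
  refine basis_induction a (by simp) (by simp +contextual) (by simp +contextual) fun a => ?_
  refine basis_induction b (by simp) (by simp +contextual) (by simp +contextual) fun b => ?_
  exact basis_induction c (by simp) (by simp +contextual) (by simp +contextual) fun c => h a b c

/-- Linear extension of `PTree.node`. -/
def nodeL : Plus K X →ₗ[K] (Branches X →₀ K) →ₗ[K] Plus K X :=
  bilin fun t bs => Finsupp.single (.node t bs) 1

/-- Linear extension of `Branches.append`. -/
def appendL : (Branches X →₀ K) →ₗ[K] (Branches X →₀ K) →ₗ[K] (Branches X →₀ K) :=
  bilin fun bs cs => Finsupp.single (bs.append cs) 1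

/-- Linear extension of `Branches.single x`. -/
def singleL (x : X) : Plus K X →ₗ[K] (Branches X →₀ K) :=
  Finsupp.lmapDomain K K fun u => Branches.single x u

/-- Linear extension of `Branches.cons x`. -/
def consL (x : X) : Plus K X →ₗ[K] (Branches X →₀ K) →ₗ[K] (Branches X →₀ K) :=
  bilin fun t bs => Finsupp.single (.cons x t bs) 1

/-- The counit: the coefficient of the tree `|`. -/
def counit : Plus K X →ₗ[K] K := Finsupp.lapply PTree.leaf

theorem nodeL_single (t : PTree X) (bs : Branches X) :
    nodeL (K := K) (Finsupp.single t 1) (Finsupp.single bs 1) = Finsupp.single (.node t bs) 1 :=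
  bilin_single _ _ _

theorem appendL_single (bs cs : Branches X) :
    appendL (K := K) (Finsupp.single bs 1) (Finsupp.single cs 1) =
      Finsupp.single (bs.append cs) 1 :=
  bilin_single _ _ _

theorem singleL_single (x : X) (t : PTree X) :
    singleL (K := K) x (Finsupp.single t 1) = Finsupp.single (.single x t) 1 := by
  simp [singleL]

theorem consL_single (x : X) (t : PTree X) (bs : Branches X) :
    consL (K := K) x (Finsupp.single t 1) (Finsupp.single bs 1) =
      Finsupp.single (.cons x t bs) 1 :=
  bilin_single _ _ _

theorem Branches.append_assoc (bs cs ds : Branches X) :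
    (bs.append cs).append ds = bs.append (cs.append ds) := by
  match bs with
  | .single x t => rfl
  | .cons x t bs =>
    simp only [Branches.append]
    rw [Branches.append_assoc bs cs ds]

theorem appendL_assoc (β γ δ : Branches X →₀ K) :
    appendL (appendL β γ) δ = appendL β (appendL γ δ) :=
  assoc_of_single _ _ _ _ (fun a b c => by simp only [appendL_single, Branches.append_assoc]) _ _ _

theorem mapDomain_node (t : PTree X) (β : Branches X →₀ K) :
    Finsupp.mapDomain (fun cs => PTree.node t cs) β = nodeL (Finsupp.single t 1) β := by
  refine basis_induction β (by simp) ?_ ?_ fun b => by simp [nodeL_single]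
  · intro a b ha hb; rw [Finsupp.mapDomain_add, ha, hb, map_add]
  · intro c a ha; rw [Finsupp.mapDomain_smul, ha, map_smul]

theorem mapDomain_node_append (t : PTree X) (β : Branches X →₀ K) (ws : Branches X) :
    Finsupp.mapDomain (fun cs => PTree.node t (cs.append ws)) β =
      nodeL (Finsupp.single t 1) (appendL β (Finsupp.single ws 1)) := by
  refine basis_induction β (by simp) ?_ ?_ fun b => by simp [nodeL_single, appendL_single]
  · intro a b ha hb; rw [Finsupp.mapDomain_add, ha, hb]; simp
  · intro c a ha; rw [Finsupp.mapDomain_smul, ha]; simp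

theorem mapDomain_node_left (a : Plus K X) (ws : Branches X) :
    Finsupp.mapDomain (fun u => PTree.node u ws) a = nodeL a (Finsupp.single ws 1) := by
  refine basis_induction a (by simp) ?_ ?_ fun b => by simp [nodeL_single]
  · intro a b ha hb; rw [Finsupp.mapDomain_add, ha, hb]; simp
  · intro c a ha; rw [Finsupp.mapDomain_smul, ha]; simp

theorem mapDomain_cons (x : X) (t : PTree X) (β : Branches X →₀ K) :
    Finsupp.mapDomain (fun cs => Branches.cons x t cs) β = consL x (Finsupp.single t 1) β := by
  refine basis_induction β (by simp) ?_ ?_ fun b => by simp [consL_single]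
  · intro a b ha hb; rw [Finsupp.mapDomain_add, ha, hb, map_add]
  · intro c a ha; rw [Finsupp.mapDomain_smul, ha, map_smul]

@[simp] theorem counit_one : counit (one : Plus K X) = 1 := by simp [counit, one]

@[simp] theorem counit_nodeL (a : Plus K X) (β : Branches X →₀ K) : counit (nodeL a β) = 0 := by
  refine basis_induction a (by simp) (by simp +contextual) (by simp +contextual) fun a => ?_
  refine basis_induction β (by simp) (by simp +contextual) (by simp +contextual) fun b => ?_
  simp [nodeL_single, counit]

/-- Every tree is `|` or the value of `nodeL` on basis elements. -/
theorem single_eq_one_or_nodeL (t : PTree X) :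
    (Finsupp.single t 1 : Plus K X) = one ∨ ∃ (u : PTree X) (bs : Branches X),
      t = .node u bs ∧
      (Finsupp.single t 1 : Plus K X) = nodeL (Finsupp.single u 1) (Finsupp.single bs 1) := by
  cases t with
  | leaf => exact Or.inl rfl
  | node u bs => exact Or.inr ⟨u, bs, rfl, (nodeL_single u bs).symm⟩

end Linear

section Axioms

variable {K : Type*} [CommRing K] {X : Type*} (q : K)

/-- Linear extension of `starLastT`. -/
def starLast : (Branches X →₀ K) →ₗ[K] Plus K X →ₗ[K] (Branches X →₀ K) := bilin (starLastT q)

theorem starProd_single (t w : PTree X) :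
    starProd q (Finsupp.single t 1) (Finsupp.single w 1) = starT q t w := bilin_single _ _ _

theorem starLast_single (bs : Branches X) (w : PTree X) :
    starLast q (Finsupp.single bs 1) (Finsupp.single w 1) = starLastT q bs w := bilin_single _ _ _

@[simp] theorem one_starProd (a : Plus K X) : starProd q one a = a := by
  refine basis_induction a (by simp) (by simp +contextual) (by simp +contextual) fun a => ?_
  rw [one, starProd_single, starT]

@[simp] theorem starProd_one (a : Plus K X) : starProd q a one = a := by
  refine basis_induction a (by simp) (by simp +contextual) (by simp +contextual) fun a => ?_
  rw [one, starProd_single]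
  cases a <;> rw [starT]

@[simp] theorem one_prec (a : Plus K X) : prec q one a = 0 := by
  refine basis_induction a (by simp) (by simp +contextual) (by simp +contextual) fun a => ?_
  rw [one, prec, bilin_single, precT]

@[simp] theorem one_dot (a : Plus K X) : dot q one a = 0 := by
  refine basis_induction a (by simp) (by simp +contextual) (by simp +contextual) fun a => ?_
  rw [one, dot, bilin_single, dotT]

@[simp] theorem dot_one (a : Plus K X) : dot q a one = 0 := by
  refine basis_induction a (by simp) (by simp +contextual) (by simp +contextual) fun a => ?_
  rw [one, dot, bilin_single]
  cases a <;> rw [dotT]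

@[simp] theorem succ_one (a : Plus K X) : succ q a one = 0 := by
  refine basis_induction a (by simp) (by simp +contextual) (by simp +contextual) fun a => ?_
  rw [one, succ, bilin_single, succT]

theorem prec_nodeL (a c : Plus K X) (β : Branches X →₀ K) :
    prec q (nodeL a β) c = nodeL a (starLast q β c) := by
  refine assoc_of_single _ _ _ _ (fun t bs w => ?_) _ _ _
  rw [nodeL_single, starLast_single, prec, bilin_single, precT, mapDomain_node]

theorem dot_nodeL (a c : Plus K X) (β γ : Branches X →₀ K) :
    dot q (nodeL a β) (nodeL c γ) = nodeL a (appendL (starLast q β c) γ) := by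
  refine basis_induction γ (by simp) (by simp +contextual) (by simp +contextual) fun ws => ?_
  refine basis_induction a (by simp) (by simp +contextual) (by simp +contextual) fun t => ?_
  refine basis_induction β (by simp) (by simp +contextual) (by simp +contextual) fun bs => ?_
  refine basis_induction c (by simp) (by simp +contextual) (by simp +contextual) fun w => ?_
  rw [nodeL_single, nodeL_single, starLast_single, dot, bilin_single, dotT, mapDomain_node_append]

theorem succ_nodeL (a c : Plus K X) (γ : Branches X →₀ K) :
    succ q a (nodeL c γ) = nodeL (starProd q a c) γ := by
  refine (assoc_of_single (nodeL (K := K) (X := X)) (starProd q) (succ q) nodeL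
    (fun t w ws => ?_) a c γ).symm
  rw [nodeL_single, starProd_single, succ, bilin_single, succT, mapDomain_node_left]

theorem starLast_singleL (x : X) (a c : Plus K X) :
    starLast q (singleL x a) c = singleL x (starProd q a c) := by
  refine basis_induction a (by simp) (by simp +contextual) (by simp +contextual) fun t => ?_
  refine basis_induction c (by simp) (by simp +contextual) (by simp +contextual) fun w => ?_
  rw [singleL_single, starLast_single, starLastT, starProd_single, singleL,
    Finsupp.lmapDomain_apply]

theorem starLast_consL (x : X) (a c : Plus K X) (β : Branches X →₀ K) :
    starLast q (consL x a β) c = consL x a (starLast q β c) := by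
  refine assoc_of_single _ _ _ _ (fun t bs w => ?_) _ _ _
  rw [consL_single, starLast_single, starLast_single, starLastT, mapDomain_cons]

theorem appendL_singleL (x : X) (a : Plus K X) (γ : Branches X →₀ K) :
    appendL (singleL x a) γ = consL x a γ := by
  refine basis_induction a (by simp) (by simp +contextual) (by simp +contextual) fun t => ?_
  refine basis_induction γ (by simp) (by simp +contextual) (by simp +contextual) fun w => ?_
  rw [singleL_single, consL_single, appendL_single, Branches.append]

theorem appendL_consL (x : X) (a : Plus K X) (β γ : Branches X →₀ K) :
    appendL (consL x a β) γ = consL x a (appendL β γ) := by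
  rw [← appendL_singleL, ← appendL_singleL, appendL_assoc]

/-- Only the last branch is affected by `starLast`. -/
theorem starLast_append (bs cs : Branches X) (w : PTree X) :
    starLast q (Finsupp.single (bs.append cs) 1) (Finsupp.single w 1) =
      appendL (Finsupp.single bs 1)
        (starLast q (Finsupp.single cs 1) (Finsupp.single w (1 : K))) := by
  match bs with
  | .single x t =>
    rw [Branches.append, ← consL_single, ← singleL_single, appendL_singleL, starLast_consL]
  | .cons x t bs =>
    rw [Branches.append, ← consL_single, ← consL_single, appendL_consL, starLast_consL,
      starLast_append bs cs w]

theorem starLast_appendL (β γ : Branches X →₀ K) (c : Plus K X) :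
    starLast q (appendL β γ) c = appendL β (starLast q γ c) :=
  assoc_of_single _ _ _ _ (fun bs cs w => by rw [appendL_single, starLast_append]) _ _ _

theorem starProd_nodeL (a c : Plus K X) (β γ : Branches X →₀ K) :
    starProd q (nodeL a β) (nodeL c γ) = prec q (nodeL a β) (nodeL c γ)
      + q • dot q (nodeL a β) (nodeL c γ) + succ q (nodeL a β) (nodeL c γ) := by
  refine basis_induction γ (by simp) ?_ ?_ fun ws => ?_
  · intro a b ha hb; simp only [map_add, ha, hb, smul_add]; abel
  · intro r a ha; simp only [map_smul, ha, smul_add, smul_comm r q]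
  refine basis_induction a (by simp) ?_ ?_ fun t => ?_
  · intro a b ha hb; simp only [map_add, ha, hb, smul_add, LinearMap.add_apply]; abel
  · intro r a ha; simp only [map_smul, ha, smul_add, smul_comm r q, LinearMap.smul_apply]
  refine basis_induction β (by simp) ?_ ?_ fun bs => ?_
  · intro a b ha hb; simp only [map_add, ha, hb, smul_add, LinearMap.add_apply]; abel
  · intro r a ha; simp only [map_smul, ha, smul_add, smul_comm r q, LinearMap.smul_apply]
  refine basis_induction c (by simp) ?_ ?_ fun w => ?_
  · intro a b ha hb; simp only [map_add, ha, hb, smul_add, LinearMap.add_apply]; abel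
  · intro r a ha; simp only [map_smul, ha, smul_add, smul_comm r q, LinearMap.smul_apply]
  rw [nodeL_single, nodeL_single, starProd_single, prec, dot, succ, bilin_single, bilin_single,
    bilin_single, starT]

end Axioms

/-! ### The axioms of tridendriform algebras -/

section Axioms

variable {K : Type*} [CommRing K] {X : Type*} (q : K)

@[simp] theorem counit_prec (a b : Plus K X) : counit (prec q a b) = 0 := by
  refine basis_induction a (by simp) (by simp +contextual) (by simp +contextual) fun t => ?_
  rcases single_eq_one_or_nodeL (K := K) t with h | ⟨u, bs, -, h⟩ <;> rw [h]
  · simp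
  · rw [prec_nodeL, counit_nodeL]

@[simp] theorem counit_succ (a b : Plus K X) : counit (succ q a b) = 0 := by
  refine basis_induction b (by simp) (by simp +contextual) (by simp +contextual) fun t => ?_
  rcases single_eq_one_or_nodeL (K := K) t with h | ⟨u, bs, -, h⟩ <;> rw [h]
  · simp
  · rw [succ_nodeL, counit_nodeL]

@[simp] theorem counit_dot (a b : Plus K X) : counit (dot q a b) = 0 := by
  refine basis_induction a (by simp) (by simp +contextual) (by simp +contextual) fun t => ?_
  refine basis_induction b (by simp) (by simp +contextual) (by simp +contextual) fun w => ?_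
  rcases single_eq_one_or_nodeL (K := K) t with h | ⟨u, bs, -, h⟩ <;>
    rcases single_eq_one_or_nodeL (K := K) w with h' | ⟨u', bs', -, h'⟩ <;> rw [h, h']
  · simp
  · simp
  · simp
  · rw [dot_nodeL, counit_nodeL]

/-- The correction term accounts for the value `0` given to `1 ≺ 1`. -/
theorem prec_one_add (a : Plus K X) : prec q a one + counit a • one = a := by
  refine basis_induction a (by simp) ?_ ?_ fun t => ?_
  · intro a b ha hb
    conv_rhs => rw [← ha, ← hb]
    simp only [map_add, add_smul, LinearMap.add_apply]; abel
  · intro c a ha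
    conv_rhs => rw [← ha]
    simp only [map_smul, smul_add, LinearMap.smul_apply, smul_eq_mul, mul_smul]
  rcases single_eq_one_or_nodeL (K := K) t with h | ⟨u, bs, -, h⟩ <;> rw [h]
  · simp
  · rw [counit_nodeL, zero_smul, add_zero, prec_nodeL]
    congr 1
    have key : ∀ bs : Branches X, starLast q (Finsupp.single bs (1 : K)) one =
        Finsupp.single bs 1 := by
      intro bs
      induction bs using Branches.rec (motive_1 := fun _ => True) with
      | leaf => trivial
      | node => trivial
      | single x t _ =>
        rw [← singleL_single, starLast_singleL, starProd_one]
      | cons x t bs _ ih =>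
        rw [← consL_single, starLast_consL, ih]
    exact key bs

theorem prec_one {a : Plus K X} (ha : counit a = 0) : prec q a one = a := by
  simpa [ha] using prec_one_add q a

theorem one_succ {a : Plus K X} (ha : counit a = 0) : succ q one a = a := by
  suffices h : succ q one a + counit a • one = a by simpa [ha] using h
  clear ha
  refine basis_induction a (by simp) ?_ ?_ fun t => ?_
  · intro a b ha hb
    conv_rhs => rw [← ha, ← hb]
    simp only [map_add, add_smul]; abel
  · intro c a ha
    conv_rhs => rw [← ha]
    simp only [map_smul, smul_add, smul_eq_mul, mul_smul]
  rcases single_eq_one_or_nodeL (K := K) t with h | ⟨u, bs, -, h⟩ <;> rw [h]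
  · simp
  · rw [counit_nodeL, zero_smul, add_zero, succ_nodeL, one_starProd]

/-- `* = ≺ + q · + ≻` outside the line spanned by `1 ⊗ 1`. -/
theorem starProd_eq (a b : Plus K X) : starProd q a b =
    prec q a b + q • dot q a b + succ q a b + (counit a * counit b) • one := by
  refine basis_induction a (by simp) ?_ ?_ fun t => ?_
  · intro a b ha hb; simp only [map_add, ha, hb, LinearMap.add_apply]; module
  · intro r a ha; simp only [map_smul, ha, LinearMap.smul_apply, smul_eq_mul]; module
  refine basis_induction b (by simp) ?_ ?_ fun w => ?_
  · intro a b ha hb; simp only [map_add, ha, hb]; module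
  · intro r a ha; simp only [map_smul, ha, smul_eq_mul]; module
  rcases single_eq_one_or_nodeL (K := K) t with h | ⟨u, bs, -, h⟩ <;>
    rcases single_eq_one_or_nodeL (K := K) w with h' | ⟨u', bs', -, h'⟩ <;> rw [h, h']
  · simp
  · rw [one_starProd, one_succ _ (counit_nodeL _ _)]; simp
  · rw [starProd_one, prec_one _ (counit_nodeL _ _)]; simp
  · rw [starProd_nodeL, counit_nodeL]; simp

mutual

/-- Associativity of `*` and `starLast_assoc_tree` are proved by simultaneous induction: for three
trees other than `|`, both sides are sums of the values of the seven tridendriform relations, and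
each relation reduces to one of the two statements for smaller trees. -/
theorem starProd_assoc_tree (t w u : PTree X) :
    starProd q (starProd q (Finsupp.single t 1) (Finsupp.single w 1)) (Finsupp.single u 1) =
      starProd q (Finsupp.single t 1)
        (starProd q (Finsupp.single w 1) (Finsupp.single u (1 : K))) := by
  match t, w, u with
  | .leaf, w, u => rw [← one, one_starProd, one_starProd]
  | .node t bs, .leaf, u => rw [← one, starProd_one, one_starProd]
  | .node t bs, .node w ws, .leaf => rw [← one, starProd_one, starProd_one]
  | .node t bs, .node w ws, .node u us =>
    have h1 := starLast_assoc_tree bs (.node w ws) (.node u us)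
    have h2 := starLast_assoc_tree bs (.node w ws) u
    have h3 := starProd_assoc_tree (.node t bs) (.node w ws) u
    simp only [← nodeL_single] at h1 h2 h3 ⊢
    generalize hT : (Finsupp.single t 1 : Plus K X) = T at *
    generalize hW : (Finsupp.single w 1 : Plus K X) = W at *
    generalize hU : (Finsupp.single u 1 : Plus K X) = U at *
    generalize hβ : (Finsupp.single bs 1 : Branches X →₀ K) = β at *
    generalize hγ : (Finsupp.single ws 1 : Branches X →₀ K) = γ at *
    generalize hδ : (Finsupp.single us 1 : Branches X →₀ K) = δ at *
    have ha : counit (nodeL T β) = 0 := counit_nodeL _ _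
    have hb : counit (nodeL W γ) = 0 := counit_nodeL _ _
    have hc : counit (nodeL U δ) = 0 := counit_nodeL _ _
    have e1 : prec q (prec q (nodeL T β) (nodeL W γ)) (nodeL U δ) =
        prec q (nodeL T β) (starProd q (nodeL W γ) (nodeL U δ)) := by
      simp only [prec_nodeL] at h1 ⊢; rw [h1]
    have e2 : prec q (succ q (nodeL T β) (nodeL W γ)) (nodeL U δ) =
        succ q (nodeL T β) (prec q (nodeL W γ) (nodeL U δ)) := by
      simp only [prec_nodeL, succ_nodeL]
    have e3 : prec q (dot q (nodeL T β) (nodeL W γ)) (nodeL U δ) =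
        dot q (nodeL T β) (prec q (nodeL W γ) (nodeL U δ)) := by
      simp only [prec_nodeL, dot_nodeL, starLast_appendL]
    have e4 : dot q (prec q (nodeL T β) (nodeL W γ)) (nodeL U δ) =
        dot q (nodeL T β) (succ q (nodeL W γ) (nodeL U δ)) := by
      simp only [prec_nodeL, dot_nodeL, succ_nodeL, h2]
    have e5 : dot q (succ q (nodeL T β) (nodeL W γ)) (nodeL U δ) =
        succ q (nodeL T β) (dot q (nodeL W γ) (nodeL U δ)) := by
      simp only [dot_nodeL, succ_nodeL]
    have e6 : dot q (dot q (nodeL T β) (nodeL W γ)) (nodeL U δ) =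
        dot q (nodeL T β) (dot q (nodeL W γ) (nodeL U δ)) := by
      simp only [dot_nodeL, starLast_appendL, appendL_assoc]
    have e7 : succ q (starProd q (nodeL T β) (nodeL W γ)) (nodeL U δ) =
        succ q (nodeL T β) (succ q (nodeL W γ) (nodeL U δ)) := by
      simp only [succ_nodeL, h3]
    generalize nodeL T β = a at *
    generalize nodeL W γ = b at *
    generalize nodeL U δ = c at *
    rw [starProd_eq q (starProd q a b) c, starProd_eq q a (starProd q b c), e7, ← e1, ha, hc,
      starProd_eq q a b, starProd_eq q b c, ha, hb, hc]
    simp only [map_add, map_smul, LinearMap.add_apply, LinearMap.smul_apply, e2, e3, e4, e5, e6,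
      zero_mul, mul_zero, zero_smul, add_zero]
    module
termination_by sizeOf t + sizeOf w + sizeOf u

theorem starLast_assoc_tree (bs : Branches X) (w u : PTree X) :
    starLast q (starLast q (Finsupp.single bs 1) (Finsupp.single w 1)) (Finsupp.single u 1) =
      starLast q (Finsupp.single bs 1)
        (starProd q (Finsupp.single w 1) (Finsupp.single u (1 : K))) := by
  match bs with
  | .single x t =>
    rw [← singleL_single, starLast_singleL, starLast_singleL, starLast_singleL,
      starProd_assoc_tree t w u]
  | .cons x t bs =>
    rw [← consL_single, starLast_consL, starLast_consL, starLast_consL,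
      starLast_assoc_tree bs w u]
termination_by sizeOf bs + sizeOf w + sizeOf u

end

theorem starProd_assoc (a b c : Plus K X) :
    starProd q (starProd q a b) c = starProd q a (starProd q b c) :=
  assoc_of_single _ _ _ _ (starProd_assoc_tree q) _ _ _

theorem starLast_assoc (β : Branches X →₀ K) (b c : Plus K X) :
    starLast q (starLast q β b) c = starLast q β (starProd q b c) :=
  assoc_of_single _ _ _ _ (starLast_assoc_tree q) _ _ _

/-! With the values `0` given to `1 ≺ 1`, `1 · 1` and `1 ≻ 1`, the seven relations of a
tridendriform algebra hold for all elements, including the unit. -/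

theorem prec_prec (a b c : Plus K X) : prec q (prec q a b) c = prec q a (starProd q b c) := by
  refine basis_induction a (by simp) (by simp +contextual) (by simp +contextual) fun t => ?_
  rcases single_eq_one_or_nodeL (K := K) t with h | ⟨u, bs, -, h⟩ <;> rw [h]
  · simp
  · simp only [prec_nodeL, starLast_assoc]

theorem succ_prec (a b c : Plus K X) : prec q (succ q a b) c = succ q a (prec q b c) := by
  refine basis_induction b (by simp) (by simp +contextual) (by simp +contextual) fun t => ?_
  rcases single_eq_one_or_nodeL (K := K) t with h | ⟨u, bs, -, h⟩ <;> rw [h]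
  · simp
  · simp only [prec_nodeL, succ_nodeL]

theorem succ_succ (a b c : Plus K X) : succ q a (succ q b c) = succ q (starProd q a b) c := by
  refine basis_induction c (by simp) (by simp +contextual) (by simp +contextual) fun t => ?_
  rcases single_eq_one_or_nodeL (K := K) t with h | ⟨u, bs, -, h⟩ <;> rw [h]
  · simp
  · simp only [succ_nodeL, starProd_assoc]

theorem dot_prec (a b c : Plus K X) : prec q (dot q a b) c = dot q a (prec q b c) := by
  refine basis_induction a (by simp) (by simp +contextual) (by simp +contextual) fun t => ?_
  refine basis_induction b (by simp) (by simp +contextual) (by simp +contextual) fun w => ?_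
  rcases single_eq_one_or_nodeL (K := K) t with h | ⟨u, bs, -, h⟩ <;>
    rcases single_eq_one_or_nodeL (K := K) w with h' | ⟨u', bs', -, h'⟩ <;> rw [h, h']
  · simp
  · simp
  · simp
  · simp only [dot_nodeL, prec_nodeL, starLast_appendL]

theorem prec_dot (a b c : Plus K X) : dot q (prec q a b) c = dot q a (succ q b c) := by
  refine basis_induction a (by simp) (by simp +contextual) (by simp +contextual) fun t => ?_
  refine basis_induction c (by simp) (by simp +contextual) (by simp +contextual) fun w => ?_
  rcases single_eq_one_or_nodeL (K := K) t with h | ⟨u, bs, -, h⟩ <;>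
    rcases single_eq_one_or_nodeL (K := K) w with h' | ⟨u', bs', -, h'⟩ <;> rw [h, h']
  · simp
  · simp
  · simp
  · simp only [dot_nodeL, prec_nodeL, succ_nodeL, starLast_assoc]

theorem succ_dot (a b c : Plus K X) : dot q (succ q a b) c = succ q a (dot q b c) := by
  refine basis_induction b (by simp) (by simp +contextual) (by simp +contextual) fun t => ?_
  refine basis_induction c (by simp) (by simp +contextual) (by simp +contextual) fun w => ?_
  rcases single_eq_one_or_nodeL (K := K) t with h | ⟨u, bs, -, h⟩ <;>
    rcases single_eq_one_or_nodeL (K := K) w with h' | ⟨u', bs', -, h'⟩ <;> rw [h, h']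
  · simp
  · simp
  · simp
  · simp only [dot_nodeL, succ_nodeL]

theorem dot_assoc (a b c : Plus K X) : dot q (dot q a b) c = dot q a (dot q b c) := by
  refine basis_induction a (by simp) (by simp +contextual) (by simp +contextual) fun t => ?_
  refine basis_induction b (by simp) (by simp +contextual) (by simp +contextual) fun v => ?_
  refine basis_induction c (by simp) (by simp +contextual) (by simp +contextual) fun w => ?_
  rcases single_eq_one_or_nodeL (K := K) t with h | ⟨u, bs, -, h⟩ <;>
    rcases single_eq_one_or_nodeL (K := K) v with h₂ | ⟨u₂, bs₂, -, h₂⟩ <;>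
    rcases single_eq_one_or_nodeL (K := K) w with h' | ⟨u', bs', -, h'⟩ <;> rw [h, h₂, h']
  iterate 7 simp
  simp only [dot_nodeL, starLast_appendL, appendL_assoc]

/-! ### The dendriform structure `(≺, q · + ≻)` -/

theorem succTilde_apply (a b : Plus K X) : succTilde q a b = q • dot q a b + succ q a b := rfl

@[simp] theorem counit_succTilde (a b : Plus K X) : counit (succTilde q a b) = 0 := by
  simp [succTilde_apply]

@[simp] theorem succTilde_one (a : Plus K X) : succTilde q a one = 0 := by
  simp [succTilde_apply]

theorem one_succTilde {a : Plus K X} (ha : counit a = 0) : succTilde q one a = a := by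
  simp [succTilde_apply, one_succ q ha]

theorem starProd_eq_left {a : Plus K X} (ha : counit a = 0) (b : Plus K X) :
    starProd q a b = prec q a b + succTilde q a b := by
  rw [starProd_eq, ha, succTilde_apply]; module

theorem succTilde_prec (a b c : Plus K X) :
    prec q (succTilde q a b) c = succTilde q a (prec q b c) := by
  simp [succTilde_apply, dot_prec, succ_prec]

theorem succTilde_dot (a b c : Plus K X) :
    dot q (succTilde q a b) c = succTilde q a (dot q b c) := by
  simp [succTilde_apply, dot_assoc, succ_dot]

/-- Together with `prec_prec` and `succTilde_prec`, this says that `≺` and `q · + ≻` form a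
dendriform algebra. -/
theorem succTilde_succTilde (a b c : Plus K X) :
    succTilde q a (succTilde q b c) = succTilde q (starProd q a b) c := by
  simp only [succTilde_apply, starProd_eq q a b, map_add, map_smul, LinearMap.add_apply,
    LinearMap.smul_apply, succ_succ, ← succ_dot, dot_assoc, prec_dot, one_dot, smul_zero]
  module

end Axioms

/-! ### The coproduct and the products -/

section Tensor

variable {K : Type*} [CommRing K]

/-- The bilinear map `(a ⊗ a', b ⊗ b') ↦ f a b ⊗ g a' b'`. -/
abbrev tmap₂ {A B C A' B' C' : Type*} [AddCommGroup A] [Module K A] [AddCommGroup B] [Module K B]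
    [AddCommGroup C] [Module K C] [AddCommGroup A'] [Module K A'] [AddCommGroup B'] [Module K B']
    [AddCommGroup C'] [Module K C'] (f : A →ₗ[K] B →ₗ[K] C) (g : A' →ₗ[K] B' →ₗ[K] C') :
    A ⊗[K] A' →ₗ[K] B ⊗[K] B' →ₗ[K] C ⊗[K] C' :=
  TensorProduct.map₂ f g

theorem tmap₂_tmul {A B C A' B' C' : Type*} [AddCommGroup A] [Module K A] [AddCommGroup B]
    [Module K B] [AddCommGroup C] [Module K C] [AddCommGroup A'] [Module K A'] [AddCommGroup B']
    [Module K B'] [AddCommGroup C'] [Module K C'] (f : A →ₗ[K] B →ₗ[K] C)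
    (g : A' →ₗ[K] B' →ₗ[K] C') (a : A) (a' : A') (b : B) (b' : B') :
    tmap₂ f g (a ⊗ₜ a') (b ⊗ₜ b') = f a b ⊗ₜ[K] g a' b' := by
  simp [tmap₂]

/-- Generalized associativity laws are inherited by tensor products. -/
theorem tmap₂_assoc {A B C D P Q A' B' C' D' P' Q' : Type*}
    [AddCommGroup A] [Module K A] [AddCommGroup B] [Module K B]
    [AddCommGroup C] [Module K C] [AddCommGroup D] [Module K D]
    [AddCommGroup P] [Module K P] [AddCommGroup Q] [Module K Q]
    [AddCommGroup A'] [Module K A'] [AddCommGroup B'] [Module K B']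
    [AddCommGroup C'] [Module K C'] [AddCommGroup D'] [Module K D']
    [AddCommGroup P'] [Module K P'] [AddCommGroup Q'] [Module K Q']
    {f₁ : P →ₗ[K] C →ₗ[K] D} {f₂ : A →ₗ[K] B →ₗ[K] P}
    {f₃ : A →ₗ[K] Q →ₗ[K] D} {f₄ : B →ₗ[K] C →ₗ[K] Q}
    {g₁ : P' →ₗ[K] C' →ₗ[K] D'} {g₂ : A' →ₗ[K] B' →ₗ[K] P'}
    {g₃ : A' →ₗ[K] Q' →ₗ[K] D'} {g₄ : B' →ₗ[K] C' →ₗ[K] Q'}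
    (hf : ∀ a b c, f₁ (f₂ a b) c = f₃ a (f₄ b c)) (hg : ∀ a b c, g₁ (g₂ a b) c = g₃ a (g₄ b c))
    (a : A ⊗[K] A') (b : B ⊗[K] B') (c : C ⊗[K] C') :
    tmap₂ f₁ g₁ (tmap₂ f₂ g₂ a b) c = tmap₂ f₃ g₃ a (tmap₂ f₄ g₄ b c) := by
  induction a with
  | zero => simp
  | add x y hx hy => simp only [map_add, LinearMap.add_apply, hx, hy]
  | tmul a a' =>
    induction b with
    | zero => simp
    | add x y hx hy => simp only [map_add, LinearMap.add_apply, hx, hy]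
    | tmul b b' =>
      induction c with
      | zero => simp
      | add x y hx hy => simp only [map_add, hx, hy]
      | tmul c c' => simp only [tmap₂_tmul, hf, hg]

end Tensor

section Coproduct

variable {K : Type*} [CommRing K] {X : Type*} (q : K)

/-- Linear extension of `deltaB`. -/
def deltaBL : (Branches X →₀ K) →ₗ[K] Plus K X ⊗[K] (Branches X →₀ K) :=
  Finsupp.lift _ K _ (deltaB q)

theorem delta_single (t : PTree X) : delta q (Finsupp.single t 1) = deltaT q t := by
  simp [delta]

theorem deltaBL_single (bs : Branches X) : deltaBL q (Finsupp.single bs 1) = deltaB q bs := by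
  simp [deltaBL]

theorem combine_tmul {Z W : Type*} (f : PTree X → Z → W) (A : Plus K X ⊗[K] Plus K X)
    (B : Plus K X ⊗[K] (Z →₀ K)) : combine q f (A ⊗ₜ B) =
      tmap₂ (starProd q) (bilin fun t z => Finsupp.single (f t z) 1) A B := by
  induction A with
  | zero => simp
  | add x y hx hy => simp only [TensorProduct.add_tmul, map_add, LinearMap.add_apply, hx, hy]
  | tmul a a' =>
    induction B with
    | zero => simp
    | add x y hx hy => simp only [TensorProduct.tmul_add, map_add, hx, hy]
    | tmul b b' => rw [tmap₂_tmul]; simp [combine]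

@[simp] theorem delta_one : delta q (one : Plus K X) = one ⊗ₜ one := by
  rw [one, delta_single, deltaT]; rfl

theorem delta_nodeL (a : Plus K X) (β : Branches X →₀ K) : delta q (nodeL a β) =
    tmap₂ (starProd q) nodeL (delta q a) (deltaBL q β) + nodeL a β ⊗ₜ one := by
  refine basis_induction a (by simp) ?_ ?_ fun t => ?_
  · intro a b ha hb
    simp only [map_add, LinearMap.add_apply, ha, hb, TensorProduct.add_tmul]; abel
  · intro r a ha
    simp only [map_smul, LinearMap.smul_apply, ha, ← TensorProduct.smul_tmul', smul_add]
  refine basis_induction β (by simp) ?_ ?_ fun bs => ?_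
  · intro a b ha hb
    simp only [map_add, ha, hb, TensorProduct.add_tmul]; abel
  · intro r a ha
    simp only [map_smul, ha, ← TensorProduct.smul_tmul', smul_add]
  rw [nodeL_single, delta_single, deltaT, combine_tmul, delta_single, deltaBL_single]
  rfl

theorem deltaBL_singleL (x : X) (a : Plus K X) : deltaBL q (singleL x a) =
    TensorProduct.map LinearMap.id (singleL x) (delta q a) := by
  refine basis_induction a (by simp) (by simp +contextual) (by simp +contextual) fun t => ?_
  rw [singleL_single, deltaBL_single, delta_single, deltaB]
  rfl

theorem deltaBL_consL (x : X) (a : Plus K X) (β : Branches X →₀ K) : deltaBL q (consL x a β) =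
    tmap₂ (starProd q) (consL x) (delta q a) (deltaBL q β) := by
  refine basis_induction a (by simp) (by simp +contextual) (by simp +contextual) fun t => ?_
  refine basis_induction β (by simp) (by simp +contextual) (by simp +contextual) fun bs => ?_
  rw [consL_single, deltaBL_single, deltaB, combine_tmul, delta_single, deltaBL_single]
  rfl

theorem tmap₂_singleL {C C' : Type*} [AddCommGroup C] [Module K C] [AddCommGroup C'] [Module K C']
    (f : Plus K X →ₗ[K] C →ₗ[K] Plus K X) (g : (Branches X →₀ K) →ₗ[K] C' →ₗ[K] (Branches X →₀ K))
    (h : Plus K X →ₗ[K] C' →ₗ[K] (Branches X →₀ K)) (x : X)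
    (hg : ∀ a c, g (singleL x a) c = h a c)
    (A : Plus K X ⊗[K] Plus K X) (B : C ⊗[K] C') :
    tmap₂ f g (TensorProduct.map LinearMap.id (singleL x) A) B = tmap₂ f h A B := by
  induction A with
  | zero => simp
  | add x y hx hy => simp only [map_add, LinearMap.add_apply, hx, hy]
  | tmul a a' =>
    induction B with
    | zero => simp
    | add x y hx hy => simp only [map_add, hx, hy]
    | tmul b b' => simp only [TensorProduct.map_tmul, tmap₂_tmul, hg, LinearMap.id_apply]

theorem deltaBL_append_tree (bs cs : Branches X) :
    deltaBL q (appendL (Finsupp.single bs 1) (Finsupp.single cs (1 : K))) =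
      tmap₂ (starProd q) appendL (deltaBL q (Finsupp.single bs 1))
        (deltaBL q (Finsupp.single cs 1)) := by
  match bs with
  | .single x t =>
    rw [← singleL_single, appendL_singleL, deltaBL_consL, deltaBL_singleL,
      tmap₂_singleL _ _ _ x (appendL_singleL x)]
  | .cons x t bs =>
    rw [← consL_single, appendL_consL, deltaBL_consL, deltaBL_append_tree bs cs, deltaBL_consL]
    exact (tmap₂_assoc (starProd_assoc q) (appendL_consL x) _ _ _).symm

theorem deltaBL_appendL (β γ : Branches X →₀ K) : deltaBL q (appendL β γ) =
      tmap₂ (starProd q) appendL (deltaBL q β) (deltaBL q γ) := by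
  refine basis_induction β (by simp) (by simp +contextual) (by simp +contextual) fun bs => ?_
  refine basis_induction γ (by simp) (by simp +contextual) (by simp +contextual) fun cs => ?_
  exact deltaBL_append_tree q bs cs

/-- The counit is a right counit of the coproduct. -/
theorem rTensor_counit_delta (a : Plus K X) :
    TensorProduct.lift (LinearMap.lsmul K (Plus K X) ∘ₗ counit).flip (delta q a) = a := by
  refine basis_induction a (by simp) (by simp +contextual) (by simp +contextual) fun t => ?_
  rcases single_eq_one_or_nodeL (K := K) t with h | ⟨u, bs, -, h⟩ <;> rw [h]
  · simp
  · rw [delta_nodeL, map_add]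
    have : ∀ (A : Plus K X ⊗[K] Plus K X) (B : Plus K X ⊗[K] (Branches X →₀ K)),
        TensorProduct.lift (LinearMap.lsmul K (Plus K X) ∘ₗ counit).flip
        (tmap₂ (starProd q) nodeL A B) = 0 := by
      intro A B
      induction A with
      | zero => simp
      | add x y hx hy => simp only [map_add, LinearMap.add_apply, hx, hy, add_zero]
      | tmul a a' =>
        induction B with
        | zero => simp
        | add x y hx hy => simp only [map_add, hx, hy, add_zero]
        | tmul b b' => rw [tmap₂_tmul]; simp
    rw [this]
    simp

/-- The part `a ⊗ 1` of a coproduct does not contribute to products which vanish on `1`. -/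
theorem tmap₂_add_one_left {f : Plus K X →ₗ[K] Plus K X →ₗ[K] Plus K X}
    {g : Plus K X →ₗ[K] Plus K X →ₗ[K] Plus K X} (hg : ∀ a, g one a = 0)
    (a : Plus K X) (A B) : tmap₂ f g (A + a ⊗ₜ[K] one) B = tmap₂ f g A B := by
  suffices h : tmap₂ f g (a ⊗ₜ[K] one) B = 0 by rw [map_add, LinearMap.add_apply, h, add_zero]
  induction B with
  | zero => simp
  | add x y hx hy => simp only [map_add, hx, hy, add_zero]
  | tmul b b' => rw [tmap₂_tmul, hg, TensorProduct.tmul_zero]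

theorem tmap₂_add_one_right {f : Plus K X →ₗ[K] Plus K X →ₗ[K] Plus K X}
    {g : Plus K X →ₗ[K] Plus K X →ₗ[K] Plus K X} (hg : ∀ a, g a one = 0)
    (a : Plus K X) (A B) : tmap₂ f g A (B + a ⊗ₜ[K] one) = tmap₂ f g A B := by
  suffices h : tmap₂ f g A (a ⊗ₜ[K] one) = 0 by rw [map_add, h, add_zero]
  induction A with
  | zero => simp
  | add x y hx hy => simp only [map_add, LinearMap.add_apply, hx, hy, add_zero]
  | tmul b b' => rw [tmap₂_tmul, hg, TensorProduct.tmul_zero]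

/-- The product of the tensor square is the sum of the three products, up to terms on which the
second factors are both `1`. -/
theorem tmap₂_starProd (A B : Plus K X ⊗[K] Plus K X) :
    tmap₂ (starProd q) (starProd q) A B =
      tmap₂ (starProd q) (prec q) A B + q • tmap₂ (starProd q) (dot q) A B +
      tmap₂ (starProd q) (succ q) A B +
      starProd q (TensorProduct.lift (LinearMap.lsmul K (Plus K X) ∘ₗ counit).flip A)
        (TensorProduct.lift (LinearMap.lsmul K (Plus K X) ∘ₗ counit).flip B) ⊗ₜ one := by
  induction A with
  | zero => simp
  | add x y hx hy =>
    simp only [map_add, LinearMap.add_apply, hx, hy, TensorProduct.add_tmul]; module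
  | tmul a a' =>
    induction B with
    | zero => simp
    | add x y hx hy => simp only [map_add, hx, hy, TensorProduct.add_tmul]; module
    | tmul b b' =>
      simp only [tmap₂_tmul]
      rw [starProd_eq q a' b']
      simp only [TensorProduct.tmul_add, TensorProduct.tmul_smul, TensorProduct.lift.tmul,
        LinearMap.flip_apply, LinearMap.comp_apply, LinearMap.lsmul_apply, map_smul,
        LinearMap.smul_apply, ← TensorProduct.smul_tmul', mul_smul]
      rw [smul_comm]

/-- The defining formula of `·` on trees other than `|`, transported to tensor products. -/
theorem tmap₂_dot_nodeL (S W : Plus K X ⊗[K] Plus K X) (B C : Plus K X ⊗[K] (Branches X →₀ K)) :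
    tmap₂ (starProd q) nodeL S
        (tmap₂ (starProd q) appendL (tmap₂ (starProd q) (starLast q) B W) C) =
      tmap₂ (starProd q) (dot q) (tmap₂ (starProd q) nodeL S B) (tmap₂ (starProd q) nodeL W C) := by
  induction C with
  | zero => simp
  | add x y hx hy => simp only [map_add, hx, hy]
  | tmul c c' =>
    induction B with
    | zero => simp
    | add x y hx hy => simp only [map_add, LinearMap.add_apply, hx, hy]
    | tmul b b' =>
      induction W with
      | zero => simp
      | add x y hx hy => simp only [map_add, LinearMap.add_apply, hx, hy]
      | tmul u u' =>
        induction S with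
        | zero => simp
        | add x y hx hy => simp only [map_add, LinearMap.add_apply, hx, hy]
        | tmul s s' => simp only [tmap₂_tmul, starProd_assoc, dot_nodeL]

theorem tmap₂_one_left {f : Plus K X →ₗ[K] Plus K X →ₗ[K] Plus K X} (g : Module.End K (Plus K X))
    (hf : ∀ a, f one a = g a) (B : Plus K X ⊗[K] Plus K X) :
    tmap₂ (starProd q) f (one ⊗ₜ[K] one) B = TensorProduct.map LinearMap.id g B := by
  induction B with
  | zero => simp
  | add x y hx hy => rw [map_add, map_add, hx, hy]
  | tmul b b' => rw [tmap₂_tmul, one_starProd, hf]; rfl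

theorem tmap₂_one_right {f : Plus K X →ₗ[K] Plus K X →ₗ[K] Plus K X} (g : Module.End K (Plus K X))
    (hf : ∀ a, f a one = g a) (B : Plus K X ⊗[K] Plus K X) :
    tmap₂ (starProd q) f B (one ⊗ₜ[K] one) = TensorProduct.map LinearMap.id g B := by
  induction B with
  | zero => simp
  | add x y hx hy => rw [map_add, map_add, LinearMap.add_apply, hx, hy]
  | tmul b b' => rw [tmap₂_tmul, starProd_one, hf]; rfl

mutual

/-- The coproduct of `t * w` and that of a list of branches multiplied by `w` are computed by
simultaneous induction on the sizes of the trees. -/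
theorem delta_starProd_tree (t w : PTree X) :
    delta q (starProd q (Finsupp.single t 1) (Finsupp.single w (1 : K))) =
      tmap₂ (starProd q) (starProd q) (delta q (Finsupp.single t 1))
        (delta q (Finsupp.single w 1)) := by
  match t, w with
  | .leaf, w =>
    rw [← one, one_starProd, delta_one]
    rw [tmap₂_one_left q LinearMap.id (one_starProd q), TensorProduct.map_id, LinearMap.id_apply]
  | .node t bs, .leaf =>
    rw [← one, starProd_one, delta_one]
    rw [tmap₂_one_right q LinearMap.id (starProd_one q), TensorProduct.map_id, LinearMap.id_apply]
  | .node t bs, .node w ws =>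
    have h1 := delta_starProd_tree (.node t bs) w
    have h2 := delta_starLast_tree bs (.node w ws)
    have h3 := delta_starLast_tree bs w
    rw [tmap₂_starProd, rTensor_counit_delta, rTensor_counit_delta, starProd_eq]
    simp only [← nodeL_single] at h1 h2 h3 ⊢
    rw [counit_nodeL, zero_mul, zero_smul, add_zero, map_add, map_add, map_smul,
      prec_nodeL, dot_nodeL, succ_nodeL, delta_nodeL q _ (starLast _ _ _), h2,
      delta_nodeL q _ (appendL _ _), deltaBL_appendL, h3, delta_nodeL q (starProd _ _ _), h1]
    have e1 := tmap₂_assoc (starProd_assoc q) (fun a b c => prec_nodeL (X := X) q a c b)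
      (delta q (Finsupp.single t 1)) (deltaBL q (Finsupp.single bs 1))
      (delta q (nodeL (Finsupp.single w 1) (Finsupp.single ws 1)))
    have e2 := tmap₂_assoc (starProd_assoc q) (fun a b c => (succ_nodeL (X := X) q a b c).symm)
      (delta q (nodeL (Finsupp.single t 1) (Finsupp.single bs 1))) (delta q (Finsupp.single w 1))
      (deltaBL q (Finsupp.single ws 1))
    have e3 : tmap₂ (starProd q) nodeL (delta q (Finsupp.single t 1))
        (tmap₂ (starProd q) appendL (tmap₂ (starProd q) (starLast q)
          (deltaBL q (Finsupp.single bs 1)) (delta q (Finsupp.single w 1)))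
          (deltaBL q (Finsupp.single ws 1))) =
        tmap₂ (starProd q) (dot q) (delta q (nodeL (Finsupp.single t 1) (Finsupp.single bs 1)))
          (delta q (nodeL (Finsupp.single w 1) (Finsupp.single ws 1))) := by
      rw [delta_nodeL, delta_nodeL, tmap₂_add_one_left (one_dot q),
        tmap₂_add_one_right (dot_one q), tmap₂_dot_nodeL]
    rw [e3, ← e1, e2, delta_nodeL q (Finsupp.single t 1) (Finsupp.single bs 1),
      delta_nodeL q (Finsupp.single w 1) (Finsupp.single ws 1), tmap₂_add_one_left (one_prec q),
      tmap₂_add_one_right (succ_one q),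
      TensorProduct.add_tmul, TensorProduct.add_tmul, ← TensorProduct.smul_tmul']
    module
termination_by sizeOf t + sizeOf w

theorem delta_starLast_tree (bs : Branches X) (w : PTree X) :
    deltaBL q (starLast q (Finsupp.single bs 1) (Finsupp.single w (1 : K))) =
      tmap₂ (starProd q) (starLast q) (deltaBL q (Finsupp.single bs 1))
        (delta q (Finsupp.single w 1)) := by
  match bs with
  | .single x t =>
    have h := delta_starProd_tree t w
    rw [← singleL_single, starLast_singleL, deltaBL_singleL, h, deltaBL_singleL]
    generalize delta q (Finsupp.single w (1 : K)) = W
    generalize delta q (Finsupp.single t (1 : K)) = S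
    induction S with
    | zero => simp
    | add x y hx hy => simp only [map_add, LinearMap.add_apply, hx, hy]
    | tmul s s' =>
      induction W with
      | zero => simp
      | add x y hx hy => simp only [map_add, hx, hy]
      | tmul u u' =>
        simp only [tmap₂_tmul, TensorProduct.map_tmul, LinearMap.id_apply, starLast_singleL]
  | .cons x t bs =>
    rw [← consL_single, starLast_consL, deltaBL_consL, delta_starLast_tree bs w, deltaBL_consL]
    exact (tmap₂_assoc (starProd_assoc q) (fun a b c => starLast_consL q x a c b) _ _ _).symm
termination_by sizeOf bs + sizeOf w

end

/-- The coproduct is multiplicative for `*`. -/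
theorem delta_starProd (a b : Plus K X) : delta q (starProd q a b) =
    tmap₂ (starProd q) (starProd q) (delta q a) (delta q b) := by
  refine basis_induction a (by simp) (by simp +contextual) (by simp +contextual) fun t => ?_
  refine basis_induction b (by simp) (by simp +contextual) (by simp +contextual) fun w => ?_
  exact delta_starProd_tree q t w

theorem deltaBL_starLast (β : Branches X →₀ K) (b : Plus K X) : deltaBL q (starLast q β b) =
    tmap₂ (starProd q) (starLast q) (deltaBL q β) (delta q b) := by
  refine basis_induction β (by simp) (by simp +contextual) (by simp +contextual) fun t => ?_
  refine basis_induction b (by simp) (by simp +contextual) (by simp +contextual) fun w => ?_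
  exact delta_starLast_tree q t w

end Coproduct

end Tridend

/-! ### Sums over the decompositions of a list -/

section Splits

variable {A N N' : Type*} [AddCommMonoid N] [AddCommMonoid N']

/-- The sum of `F u v` over all decompositions `l = u ++ v`. -/
def sumSplits (F : List A → List A → N) : List A → N
  | [] => F [] []
  | a :: l => F [] (a :: l) + sumSplits (fun u v => F (a :: u) v) l

theorem sumSplits_congr {F G : List A → List A → N} {l : List A}
    (h : ∀ u v, u ++ v = l → F u v = G u v) : sumSplits F l = sumSplits G l := by
  induction l generalizing F G with
  | nil => exact h _ _ rfl
  | cons a l ih =>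
    rw [sumSplits, sumSplits, h _ _ rfl, ih fun u v huv => h (a :: u) v (by rw [← huv]; rfl)]

theorem sumSplits_congr' {F G : List A → List A → N} (l : List A)
    (h : ∀ u v, F u v = G u v) : sumSplits F l = sumSplits G l :=
  sumSplits_congr fun u v _ => h u v

theorem map_sumSplits {H : Type*} [FunLike H N N'] [AddMonoidHomClass H N N'] (φ : H)
    (F : List A → List A → N) (l : List A) :
    φ (sumSplits F l) = sumSplits (fun u v => φ (F u v)) l := by
  induction l generalizing F with
  | nil => rfl
  | cons a l ih => rw [sumSplits, sumSplits, map_add, ih]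

theorem sumSplits_add (F G : List A → List A → N) (l : List A) :
    sumSplits (fun u v => F u v + G u v) l = sumSplits F l + sumSplits G l := by
  induction l generalizing F G with
  | nil => rfl
  | cons a l ih => simp only [sumSplits, ih]; abel

theorem sumSplits_zero (l : List A) : sumSplits (fun _ _ => (0 : N)) l = 0 := by
  induction l with
  | nil => rfl
  | cons a l ih => rw [sumSplits, ih, add_zero]

theorem sumSplits_sub {N : Type*} [AddCommGroup N] (F G : List A → List A → N) (l : List A) :
    sumSplits (fun u v => F u v - G u v) l = sumSplits F l - sumSplits G l := by
  induction l generalizing F G with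
  | nil => rfl
  | cons a l ih => simp only [sumSplits, ih]; abel

theorem smul_sumSplits {K : Type*} [Semiring K] [Module K N] (c : K) (F : List A → List A → N)
    (l : List A) : c • sumSplits F l = sumSplits (fun u v => c • F u v) l :=
  map_sumSplits (DistribSMul.toAddMonoidHom N c) F l

theorem sumSplits_comm (F : List A → List A → List A → List A → N) (l k : List A) :
    sumSplits (fun a b => sumSplits (fun c d => F a b c d) k) l =
      sumSplits (fun c d => sumSplits (fun a b => F a b c d) l) k := by
  induction l generalizing F with
  | nil => rfl
  | cons a l ih => simp only [sumSplits, ih, sumSplits_add]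

/-- Coassociativity of deconcatenation. -/
theorem sumSplits_assoc (F : List A → List A → List A → N) (l : List A) :
    sumSplits (fun u v => sumSplits (fun u₁ u₂ => F u₁ u₂ v) u) l =
      sumSplits (fun u v => sumSplits (fun v₁ v₂ => F u v₁ v₂) v) l := by
  induction l generalizing F with
  | nil => rfl
  | cons a l ih => simp only [sumSplits, sumSplits_add, ih]; abel

theorem sumSplits_assoc₃ (F : List A → List A → List A → List A → N) (l : List A) :
    sumSplits (fun w d => sumSplits (fun a v => sumSplits (fun b c => F a b c d) v) w) l =
      sumSplits (fun a v => sumSplits (fun b v' => sumSplits (fun c d => F a b c d) v') v) l := by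
  rw [sumSplits_assoc fun a v d => sumSplits (fun b c => F a b c d) v]
  exact sumSplits_congr' _ fun a v => sumSplits_assoc (fun b c d => F a b c d) v

theorem sumSplits_append_cons (F : List A → List A → N) (l r : List A) (m : A) :
    sumSplits F (l ++ m :: r) = sumSplits (fun u v => F u (v ++ m :: r)) l +
      sumSplits (fun u v => F (l ++ m :: u) v) r := by
  induction l generalizing F with
  | nil => rfl
  | cons a l ih => simp only [List.cons_append, sumSplits, ih, add_assoc]

theorem sumSplits_eq_last {F : List A → List A → N} {l : List A}
    (h : ∀ u v, u ++ v = l → v ≠ [] → F u v = 0) : sumSplits F l = F l [] := by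
  induction l generalizing F with
  | nil => rfl
  | cons a l ih =>
    rw [sumSplits, h [] (a :: l) rfl (by simp), zero_add,
      ih fun u v huv hv => h (a :: u) v (by rw [← huv]; rfl) hv]

/-- A family of elements vanishes if its convolution products with a family starting with the
unit do. -/
theorem eq_zero_of_sumSplits {D : List A → N} (T : N → List A → N) (h0 : ∀ v, T 0 v = 0)
    (h1 : ∀ l, T (D l) [] = D l) (h : ∀ l, sumSplits (fun u v => T (D u) v) l = 0) (l : List A) :
    D l = 0 := by
  induction hn : l.length using Nat.strong_induction_on generalizing l with
  | _ n ih =>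
    rw [← h1, ← h l, sumSplits_eq_last]
    intro u v huv hv
    rw [ih u.length _ u rfl, h0]
    rw [← hn, ← huv, List.length_append]
    have := List.length_pos_iff.mpr hv
    omega

theorem sumSplits_eq_sum_range (F : List A → List A → N) (l : List A) :
    sumSplits F l = ∑ i ∈ Finset.range (l.length + 1), F (l.take i) (l.drop i) := by
  induction l generalizing F with
  | nil => simp [sumSplits]
  | cons a l ih =>
    rw [sumSplits, ih, List.length_cons, Finset.sum_range_succ' _ (l.length + 1), add_comm]
    simp

theorem sumSplits_drop_eq_sum_Icc (F : List A → List A → N) (l : List A) {i : ℕ}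
    (hi : i ≤ l.length) :
    sumSplits F (l.drop i) = ∑ j ∈ Finset.Icc i l.length, F ((l.take j).drop i) (l.drop j) := by
  rw [sumSplits_eq_sum_range, List.length_drop, Finset.range_eq_Ico]
  refine Finset.sum_bij (fun k _ => k + i) ?_ ?_ ?_ ?_
  · intro k hk
    simp only [Finset.mem_Ico, Finset.mem_Icc] at hk ⊢
    omega
  · intro a _ b _ hab
    omega
  · intro j hj
    simp only [Finset.mem_Icc] at hj
    exact ⟨j - i, by simp only [Finset.mem_Ico]; omega, by omega⟩
  · intro k hk
    rw [List.drop_take, List.drop_drop, Nat.add_sub_cancel, add_comm]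

/-- The sums over `0 ≤ i ≤ j ≤ n` in the axioms of `GV_q` algebras. -/
theorem sum_range_Icc_eq_sumSplits (F : List A → List A → List A → N) (l : List A) :
    ∑ i ∈ Finset.range (l.length + 1), ∑ j ∈ Finset.Icc i l.length,
      F (l.take i) ((l.take j).drop i) (l.drop j) =
      sumSplits (fun u v => sumSplits (fun v₁ v₂ => F u v₁ v₂) v) l := by
  rw [sumSplits_eq_sum_range]
  refine Finset.sum_congr rfl fun i hi => ?_
  rw [sumSplits_drop_eq_sum_Icc _ _ (by simpa [Nat.lt_succ_iff] using hi)]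

theorem sum_range_Icc_sub_eq_sumSplits (F : ℕ → List A → List A → List A → N) (l : List A) :
    ∑ i ∈ Finset.range (l.length + 1), ∑ j ∈ Finset.Icc i l.length,
      F (j - i) (l.take i) ((l.take j).drop i) (l.drop j) =
      sumSplits (fun u v => sumSplits (fun v₁ v₂ => F v₁.length u v₁ v₂) v) l := by
  rw [← sum_range_Icc_eq_sumSplits (fun u v₁ v₂ => F v₁.length u v₁ v₂)]
  refine Finset.sum_congr rfl fun i _ => Finset.sum_congr rfl fun j hj => ?_
  have : ((l.take j).drop i).length = j - i := by
    simp only [List.length_drop, List.length_take]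
    have := (Finset.mem_Icc.1 hj).2
    omega
  rw [this]

/-! ### The product on words of a brace algebra -/

/-- The sum of `F w` over the words `w` occurring in the product of the words `zs` and
`ys = [y₁, …, yₙ]` of elements of a brace algebra: these words are
`z₁ ⋯ z_{i₁} M(y₁; z_{i₁+1}, …, z_{j₁}) z_{j₁+1} ⋯ M(yₙ; z_{iₙ+1}, …, z_{jₙ}) ⋯ z_m`. -/
def braceWord (M : A → List A → A) (F : List A → N) : List A → List A → N
  | [], zs => F zs
  | y :: ys, zs => sumSplits (fun u v => sumSplits
      (fun v₁ v₂ => braceWord M (fun l => F (u ++ M y v₁ :: l)) ys v₂) v) zs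

theorem map_braceWord {H : Type*} [FunLike H N N'] [AddMonoidHomClass H N N'] (φ : H)
    (M : A → List A → A) (F : List A → N) (ys zs : List A) :
    φ (braceWord M F ys zs) = braceWord M (fun l => φ (F l)) ys zs := by
  induction ys generalizing F zs with
  | nil => rfl
  | cons y ys ih => simp only [braceWord, map_sumSplits, ih]

theorem braceWord_add (M : A → List A → A) (F G : List A → N) (ys zs : List A) :
    braceWord M (fun l => F l + G l) ys zs = braceWord M F ys zs + braceWord M G ys zs := by
  induction ys generalizing F G zs with
  | nil => rfl
  | cons y ys ih => simp only [braceWord, ih, sumSplits_add]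

theorem braceWord_sumSplits (M : A → List A → A) (F : List A → List A → List A → N)
    (ys zs k : List A) :
    braceWord M (fun l => sumSplits (fun u v => F u v l) k) ys zs =
      sumSplits (fun u v => braceWord M (F u v) ys zs) k := by
  induction ys generalizing F zs with
  | nil => rfl
  | cons y ys ih =>
    simp only [braceWord, ih]
    rw [sumSplits_comm]
    exact sumSplits_congr' _ fun u v => sumSplits_comm _ _ _

/-- The product of words is compatible with deconcatenation. -/
theorem braceWord_deconcatenation (M : A → List A → A) (G : List A → List A → N)
    (ys zs : List A) :
    braceWord M (fun l => sumSplits G l) ys zs =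
      sumSplits (fun y₁ y₂ => sumSplits (fun z₁ z₂ =>
        braceWord M (fun u₁ => braceWord M (fun u₂ => G u₁ u₂) y₂ z₂) y₁ z₁) zs) ys := by
  induction ys generalizing G zs with
  | nil => rfl
  | cons y ys ih =>
    simp only [braceWord, sumSplits_append_cons, braceWord_add, sumSplits_add, braceWord_sumSplits,
      ih]
    rw [sumSplits]
    congr 1
    · simp only [braceWord]
      refine Eq.trans ?_ (sumSplits_assoc (fun u v r => sumSplits (fun v₁ v₂ =>
        braceWord M (fun l => G u (v ++ M y v₁ :: l)) ys v₂) r) zs)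
      exact sumSplits_congr' _ fun z r => sumSplits_comm _ _ _
    · simp only [braceWord]
      refine Eq.trans ?_ (sumSplits_congr' _ fun y₁ y₂ =>
        (sumSplits_assoc₃ (fun a b c d => braceWord M
          (fun u₁ => braceWord M (fun u₂ => G (a ++ M y b :: u₁) u₂) y₂ d) y₁ c) zs).symm)
      rw [sumSplits_comm]
      refine sumSplits_congr' _ fun a r => ?_
      rw [sumSplits_comm]

theorem braceSum_eq_braceWord [AddCommMonoid A] (M : A → List A → A) (x : A)
    (acc ys zs : List A) :
    braceSum M x acc ys zs = braceWord M (fun l => M x (acc ++ l)) ys zs := by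
  induction ys generalizing acc zs with
  | nil => rfl
  | cons y ys ih =>
    simp only [braceSum, braceWord, ih, List.append_assoc, List.singleton_append]
    exact sum_range_Icc_eq_sumSplits
      (fun u v r => braceWord M (fun l => M x (acc ++ (u ++ M y v :: l))) ys r) zs

theorem sumSplits_map {B : Type*} (f : A → B) (F : List B → List B → N)
    (l : List A) : sumSplits F (l.map f) = sumSplits (fun u v => F (u.map f) (v.map f)) l := by
  induction l generalizing F with
  | nil => rfl
  | cons a l ih => simp only [List.map_cons, sumSplits, ih, List.map_nil]

theorem map_sumSplits_list {B : Type*}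
    (g : N →+ N') (h : A → B)
    {F : List A → List A → N} {G : List B → List B → N'}
    (l : List A) (hFG : ∀ u v, u ++ v = l → g (F u v) = G (u.map h) (v.map h)) :
    g (sumSplits F l) = sumSplits G (l.map h) := by
  rw [map_sumSplits, sumSplits_map]
  exact sumSplits_congr hFG

theorem map_braceWord_list {B : Type*}
    (g : N →+ N') (h : A → B) {M : A → List A → A} {M' : B → List B → B}
    {F : List A → N} {G : List B → N'} (ys zs : List A) (hFG : ∀ l, g (F l) = G (l.map h))
    (hM : ∀ y ∈ ys, ∀ l, h (M y l) = M' (h y) (l.map h)) :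
    g (braceWord M F ys zs) = braceWord M' G (ys.map h) (zs.map h) := by
  induction ys generalizing F G zs with
  | nil => exact hFG _
  | cons y ys ih =>
    refine map_sumSplits_list g h zs fun u v _ => map_sumSplits_list g h v fun v₁ v₂ _ => ?_
    refine ih _ (fun l => ?_) fun y hy => hM y (by simp [hy])
    rw [hFG, List.map_append, List.map_cons, hM y (by simp)]

end Splits

namespace Tridend

/-! ### Primitive elements -/

section Primitive

variable {K : Type*} [CommRing K] {X : Type*} (q : K)

/-- The term `(a ≺ b) ⊗ 1` replaces the undefined `(a₍₁₎ * b₍₁₎) ⊗ (1 ≺ 1)`, which counts as `0`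
here; likewise for the other products. -/
theorem delta_prec (a b : Plus K X) : delta q (prec q a b) =
    prec q a b ⊗ₜ one + tmap₂ (starProd q) (prec q) (delta q a) (delta q b) := by
  refine basis_induction a (by simp) ?_ ?_ fun t => ?_
  · intro a b ha hb
    simp only [map_add, LinearMap.add_apply, ha, hb, TensorProduct.add_tmul]; abel
  · intro r a ha
    simp only [map_smul, LinearMap.smul_apply, ha, ← TensorProduct.smul_tmul', smul_add]
  rcases single_eq_one_or_nodeL (K := K) t with h | ⟨u, bs, -, h⟩ <;> rw [h]
  · rw [delta_one, tmap₂_one_left q 0 (one_prec q), TensorProduct.map_zero_right]; simp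
  · rw [delta_nodeL, tmap₂_add_one_left (one_prec q), prec_nodeL, delta_nodeL, deltaBL_starLast,
      add_comm, tmap₂_assoc (starProd_assoc q) (fun a b c => prec_nodeL (X := X) q a c b)]

theorem delta_succ (a b : Plus K X) : delta q (succ q a b) =
    succ q a b ⊗ₜ one + tmap₂ (starProd q) (succ q) (delta q a) (delta q b) := by
  refine basis_induction b (by simp) ?_ ?_ fun t => ?_
  · intro a b ha hb
    simp only [map_add, ha, hb, TensorProduct.add_tmul]; abel
  · intro r a ha
    simp only [map_smul, ha, ← TensorProduct.smul_tmul', smul_add]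
  rcases single_eq_one_or_nodeL (K := K) t with h | ⟨u, bs, -, h⟩ <;> rw [h]
  · rw [delta_one, tmap₂_one_right q 0 (succ_one q), TensorProduct.map_zero_right]; simp
  · rw [delta_nodeL, tmap₂_add_one_right (succ_one q), succ_nodeL, delta_nodeL, delta_starProd,
      add_comm, tmap₂_assoc (starProd_assoc q) (fun a b c => (succ_nodeL (X := X) q a b c).symm)]

theorem delta_dot (a b : Plus K X) : delta q (dot q a b) =
    dot q a b ⊗ₜ one + tmap₂ (starProd q) (dot q) (delta q a) (delta q b) := by
  refine basis_induction a (by simp) ?_ ?_ fun t => ?_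
  · intro a b ha hb
    simp only [map_add, LinearMap.add_apply, ha, hb, TensorProduct.add_tmul]; abel
  · intro r a ha
    simp only [map_smul, LinearMap.smul_apply, ha, ← TensorProduct.smul_tmul', smul_add]
  refine basis_induction b (by simp) ?_ ?_ fun w => ?_
  · intro a b ha hb
    simp only [map_add, ha, hb, TensorProduct.add_tmul]; abel
  · intro r a ha
    simp only [map_smul, ha, ← TensorProduct.smul_tmul', smul_add]
  rcases single_eq_one_or_nodeL (K := K) t with h | ⟨u, bs, -, h⟩
  · rw [h, delta_one, tmap₂_one_left q 0 (one_dot q), TensorProduct.map_zero_right]; simp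
  rcases single_eq_one_or_nodeL (K := K) w with h' | ⟨u', bs', -, h'⟩
  · rw [h', delta_one, tmap₂_one_right q 0 (dot_one q), TensorProduct.map_zero_right]; simp
  rw [h, h', delta_nodeL q (Finsupp.single u 1), delta_nodeL q (Finsupp.single u' 1),
    tmap₂_add_one_left (one_dot q), tmap₂_add_one_right (dot_one q), ← tmap₂_dot_nodeL, dot_nodeL,
    delta_nodeL, deltaBL_appendL, deltaBL_starLast, add_comm]

theorem delta_succTilde (a b : Plus K X) : delta q (succTilde q a b) =
    succTilde q a b ⊗ₜ one + tmap₂ (starProd q) (succTilde q) (delta q a) (delta q b) := by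
  have : ∀ A B : Plus K X ⊗[K] Plus K X, tmap₂ (starProd q) (succTilde q) A B =
      q • tmap₂ (starProd q) (dot q) A B + tmap₂ (starProd q) (succ q) A B := by
    intro A B
    induction A with
    | zero => simp
    | add x y hx hy => simp only [map_add, LinearMap.add_apply, hx, hy]; module
    | tmul a a' =>
      induction B with
      | zero => simp
      | add x y hx hy => simp only [map_add, hx, hy]; module
      | tmul b b' => simp only [tmap₂_tmul, succTilde_apply, TensorProduct.tmul_add,
          TensorProduct.tmul_smul]
  rw [this, succTilde_apply, map_add, map_smul, delta_dot, delta_succ, TensorProduct.add_tmul,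
    ← TensorProduct.smul_tmul']
  module

variable {q}

theorem mem_Prim {a : Plus K X} :
    a ∈ Prim X q ↔ delta q a = a ⊗ₜ[K] one + one ⊗ₜ[K] a := Iff.rfl

/-- Applying the counit to `Δ(a) = a ⊗ 1 + 1 ⊗ a` gives `ε(a) = ε(a) + ε(a)`. -/
theorem counit_of_mem_Prim {a : Plus K X} (ha : a ∈ Prim X q) : counit a = 0 := by
  have h := congrArg counit (rTensor_counit_delta q a)
  rw [mem_Prim.1 ha] at h
  simpa using h

/-- The trees `gen x` are primitive. -/
theorem gen_mem_Prim (x : X) : (Finsupp.single (PTree.gen x) 1 : Plus K X) ∈ Prim X q := by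
  rw [mem_Prim, PTree.gen, ← nodeL_single, ← singleL_single, delta_nodeL, deltaBL_singleL]
  have h : (Finsupp.single PTree.leaf 1 : Plus K X) = one := rfl
  rw [h, delta_one, TensorProduct.map_tmul, tmap₂_tmul, add_comm]
  simp

theorem dot_mem_Prim {a b : Plus K X} (ha : a ∈ Prim X q) (hb : b ∈ Prim X q) :
    dot q a b ∈ Prim X q := by
  rw [mem_Prim, delta_dot, mem_Prim.1 ha, mem_Prim.1 hb]
  simp only [map_add, LinearMap.add_apply, tmap₂_tmul, one_dot, dot_one, TensorProduct.tmul_zero,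
    starProd_one, add_zero, zero_add]

variable (q)

/-! ### The brace operations on primitive elements -/

@[simp] theorem omegaPrec_nil : omegaPrec q ([] : List (Plus K X)) = one := rfl

@[simp] theorem omegaPrec_cons (y : Plus K X) (ys : List (Plus K X)) :
    omegaPrec q (y :: ys) = prec q y (omegaPrec q ys) := rfl

theorem braceOp_eq_sumSplits (x : Plus K X) (ys : List (Plus K X)) :
    braceOp q x ys = sumSplits (fun u v => (-1 : K) ^ v.length •
      prec q (succTilde q (omegaPrec q u) x) (omegaSucc q v)) ys := by
  rw [sumSplits_eq_sum_range, braceOp]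
  simp only [List.length_drop]

theorem counit_braceOp (x : Plus K X) (ys : List (Plus K X)) : counit (braceOp q x ys) = 0 := by
  rw [braceOp_eq_sumSplits, map_sumSplits]
  simp [sumSplits_zero]

theorem braceOp_nil {x : Plus K X} (hx : counit x = 0) : braceOp q x [] = x := by
  simp [braceOp, omegaSucc, one_succTilde q hx, prec_one q hx]

/-- The sum telescopes, since `a * b = a ≺ b + a ≻ b` with `≻` standing for `q · + ≻`. -/
theorem sumSplits_foldl_starProd_omegaPrec {a : Plus K X} (ha : counit a = 0)
    (l : List (Plus K X)) :
    sumSplits (fun u v => (-1 : K) ^ u.length •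
      starProd q (u.foldl (fun a y => succTilde q a y) a) (omegaPrec q v)) l =
      prec q a (omegaPrec q l) := by
  induction l generalizing a with
  | nil => simp [sumSplits, prec_one q ha]
  | cons y l ih =>
    rw [sumSplits]
    simp only [List.foldl_cons, List.length_cons, pow_succ, mul_neg_one, neg_smul]
    have h := smul_sumSplits (-1 : K) (fun u v => (-1 : K) ^ u.length •
      starProd q (u.foldl (fun a y => succTilde q a y) (succTilde q a y)) (omegaPrec q v)) l
    rw [ih (counit_succTilde q a y)] at h
    simp only [smul_smul, neg_one_mul, neg_smul] at h
    simp only [← h, List.foldl_nil, List.length_nil, pow_zero, one_smul, omegaPrec_cons]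
    rw [starProd_eq_left q ha, succTilde_prec]
    simp

/-- The elements `ω_≻` and `ω_≺` are, up to signs, convolution inverse to each other. -/
theorem sumSplits_omegaSucc_starProd_omegaPrec {l : List (Plus K X)} (hl : ∀ y ∈ l, counit y = 0)
    (h : l ≠ []) : sumSplits (fun u v => (-1 : K) ^ u.length •
      starProd q (omegaSucc q u) (omegaPrec q v)) l = 0 := by
  obtain ⟨y, l, rfl⟩ := List.exists_cons_of_ne_nil h
  have hy := hl y (by simp)
  have h := smul_sumSplits (-1 : K) (fun u v => (-1 : K) ^ u.length •
      starProd q (u.foldl (fun a y => succTilde q a y) y) (omegaPrec q v)) l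
  rw [sumSplits_foldl_starProd_omegaPrec q hy] at h
  simp only [smul_smul] at h
  simp only [sumSplits, omegaSucc, List.foldl_cons, List.length_cons, pow_succ', one_succTilde q hy,
    ← h]
  simp

/-- The recursive characterization of the brace operations:
`ω_≺(y₁, …, yₙ) ≻ x = ∑ᵢ M(x; y₁, …, yᵢ) ≺ ω_≺(y_{i+1}, …, yₙ)` for the product
`≻` replaced by `q · + ≻`. -/
theorem succTilde_omegaPrec (x : Plus K X) {l : List (Plus K X)} (hl : ∀ y ∈ l, counit y = 0) :
    succTilde q (omegaPrec q l) x =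
      sumSplits (fun u v => prec q (braceOp q x u) (omegaPrec q v)) l := by
  have h : sumSplits (fun u v => prec q (braceOp q x u) (omegaPrec q v)) l =
      sumSplits (fun a v => prec q (succTilde q (omegaPrec q a) x)
        (sumSplits (fun b c => (-1 : K) ^ b.length •
          starProd q (omegaSucc q b) (omegaPrec q c)) v)) l := by
    refine (Eq.trans ?_ (sumSplits_assoc (fun a b c => prec q (succTilde q (omegaPrec q a) x)
        ((-1 : K) ^ b.length • starProd q (omegaSucc q b) (omegaPrec q c))) l)).trans
        (sumSplits_congr' _ fun u v => (map_sumSplits _ _ _).symm)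
    refine sumSplits_congr' _ fun u v => ?_
    rw [braceOp_eq_sumSplits, ← LinearMap.flip_apply, map_sumSplits]
    refine sumSplits_congr' _ fun a b => ?_
    rw [LinearMap.flip_apply, map_smul, LinearMap.smul_apply, map_smul, prec_prec]
  rw [h, sumSplits_eq_last]
  · simp [sumSplits, omegaSucc, prec_one q]
  · intro u v huv hv
    rw [sumSplits_omegaSucc_starProd_omegaPrec q _ hv, map_zero]
    intro y hy
    exact hl y (by rw [← huv]; exact List.mem_append_right _ hy)

variable {q}

/-- The map `(y₁, …, yₙ) ↦ ω_≺(y₁, …, yₙ)` takes deconcatenation of words of primitive elements to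
the coproduct (with the two factors exchanged). -/
theorem delta_omegaPrec {l : List (Plus K X)} (hl : ∀ y ∈ l, y ∈ Prim X q) :
    delta q (omegaPrec q l) =
      sumSplits (fun u v => omegaPrec q v ⊗ₜ[K] omegaPrec q u) l := by
  induction l with
  | nil => simp [sumSplits]
  | cons y l ih =>
    rw [omegaPrec_cons, delta_prec, mem_Prim.1 (hl y (by simp)),
      ih fun z hz => hl z (by simp [hz]), sumSplits, omegaPrec_nil, omegaPrec_cons]
    congr 1
    rw [map_sumSplits]
    refine sumSplits_congr' _ fun u v => ?_
    simp only [map_add, LinearMap.add_apply, tmap₂_tmul, one_prec, TensorProduct.tmul_zero,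
      one_starProd, zero_add, omegaPrec_cons]

/-- The brace operations preserve primitive elements: by induction on the length, comparing the
coproducts of the two sides of `succTilde_omegaPrec`. -/
theorem braceOp_mem_Prim {x : Plus K X} (hx : x ∈ Prim X q) {l : List (Plus K X)}
    (hl : ∀ y ∈ l, y ∈ Prim X q) : braceOp q x l ∈ Prim X q := by
  induction hn : l.length using Nat.strong_induction_on generalizing l with
  | _ n ih =>
    -- `F u v = 0` if `M(x; u)` is primitive, and the sum of all `F u v` vanishes.
    let F : List (Plus K X) → List (Plus K X) → Plus K X ⊗[K] Plus K X := fun u v =>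
      delta q (prec q (braceOp q x u) (omegaPrec q v)) -
        (prec q (braceOp q x u) (omegaPrec q v) ⊗ₜ[K] one +
        sumSplits (fun a b => omegaPrec q b ⊗ₜ[K] prec q (braceOp q x u) (omegaPrec q a)) v)
    have h1 : sumSplits F l = F l [] := by
      refine sumSplits_eq_last fun u v huv hv => ?_
      have hu : braceOp q x u ∈ Prim X q := by
        refine ih u.length ?_ (fun y hy => hl y (by simp [← huv, hy])) rfl
        rw [← hn, ← huv, List.length_append]
        have := List.length_pos_iff.mpr hv
        omega
      have hv' : ∀ y ∈ v, y ∈ Prim X q := fun y hy => hl y (by simp [← huv, hy])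
      simp only [F]
      rw [delta_prec, mem_Prim.1 hu, delta_omegaPrec hv', map_sumSplits, sub_eq_zero]
      congr 1
      refine sumSplits_congr' _ fun u v => ?_
      simp only [map_add, LinearMap.add_apply, tmap₂_tmul, one_prec, TensorProduct.tmul_zero,
        one_starProd, zero_add]
    have hl' : ∀ y ∈ l, counit y = 0 := fun y hy => counit_of_mem_Prim (hl y hy)
    have h2 : sumSplits F l = 0 := by
      simp only [F, sumSplits_sub, sumSplits_add]
      rw [← map_sumSplits (delta q), ← succTilde_omegaPrec q x hl', delta_succTilde,
        delta_omegaPrec hl, mem_Prim.1 hx, sub_eq_zero]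
      congr 1
      · rw [succTilde_omegaPrec q x hl']
        exact map_sumSplits ((TensorProduct.mk K (Plus K X) (Plus K X)).flip one) _ l
      · rw [← sumSplits_assoc (fun u a b => omegaPrec q b ⊗ₜ[K] prec q (braceOp q x u)
          (omegaPrec q a)), ← LinearMap.flip_apply, map_sumSplits]
        refine sumSplits_congr fun u v huv => ?_
        rw [LinearMap.flip_apply]
        simp only [map_add, tmap₂_tmul, succTilde_one, TensorProduct.tmul_zero, starProd_one,
          zero_add]
        rw [succTilde_omegaPrec q x fun y hy => hl' y (by simp [← huv, hy])]
        exact map_sumSplits (TensorProduct.mk K (Plus K X) (Plus K X) (omegaPrec q v)) _ u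
    rw [h1] at h2
    simp only [F, sumSplits, omegaPrec_nil, prec_one q (counit_braceOp q x l)] at h2
    exact mem_Prim.2 (sub_eq_zero.1 h2)

end Primitive

end Tridend

/-! ### Functions of a list which are linear in each entry -/

section Multilinear

variable {K : Type*} [CommRing K] {A N N' : Type*} [AddCommGroup A] [Module K A]
  [AddCommGroup N] [Module K N] [AddCommGroup N'] [Module K N']

variable (K) in
/-- The function `F` is linear in each entry of its argument. -/
def IsMultilinear (F : List A → N) : Prop :=
  ∀ (c : K) (u : List A) (y y' : A) (v : List A),
    F (u ++ (c • y + y') :: v) = c • F (u ++ y :: v) + F (u ++ y' :: v)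

theorem IsMultilinear.map_add {F : List A → N} (hF : IsMultilinear K F) (u : List A) (y y' : A)
    (v : List A) : F (u ++ (y + y') :: v) = F (u ++ y :: v) + F (u ++ y' :: v) := by
  simpa using hF 1 u y y' v

theorem IsMultilinear.map_zero {F : List A → N} (hF : IsMultilinear K F) (u v : List A) :
    F (u ++ 0 :: v) = 0 := by
  have := hF.map_add u 0 0 v
  simpa using this

theorem IsMultilinear.map_smul {F : List A → N} (hF : IsMultilinear K F) (c : K) (u : List A)
    (y : A) (v : List A) : F (u ++ (c • y) :: v) = c • F (u ++ y :: v) := by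
  simpa [hF.map_zero] using hF c u y 0 v

theorem IsMultilinear.sumSplits {F : List A → List A → N}
    (h₁ : ∀ v, IsMultilinear K fun u => F u v) (h₂ : ∀ u, IsMultilinear K (F u)) :
    IsMultilinear K (sumSplits F) := by
  intro c u y y' v
  simp only [sumSplits_append_cons, smul_add, smul_sumSplits]
  rw [sumSplits_congr' u fun a b => h₂ a c b y y' v,
    sumSplits_congr' v fun a b => h₁ b c u y y' a, sumSplits_add, sumSplits_add]
  abel

theorem IsMultilinear.comp {F : List A → N} (hF : IsMultilinear K F) (φ : N →ₗ[K] N') :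
    IsMultilinear K fun l => φ (F l) := by
  intro c u y y' v
  change φ _ = c • φ _ + φ _
  rw [hF, _root_.map_add, _root_.map_smul]

/-- The values of a function which is linear in each entry lie in a submodule if those on the lists
of elements of a spanning set do. -/
theorem IsMultilinear.mem_of_span {F : List A → N} (hF : IsMultilinear K F) {s : Set A}
    {W : Submodule K N} (h : ∀ l : List A, (∀ y ∈ l, y ∈ s) → F l ∈ W) (l : List A)
    (hl : ∀ y ∈ l, y ∈ Submodule.span K s) : F l ∈ W := by
  suffices key : ∀ l u : List A, (∀ y ∈ l, y ∈ Submodule.span K s) → (∀ y ∈ u, y ∈ s) →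
      F (u ++ l) ∈ W from key l [] hl (by simp)
  clear hl l
  intro l
  induction l with
  | nil => intro u _ hu; simpa using h u hu
  | cons y l ih =>
    intro u hl hu
    have hy := hl y (by simp)
    have hl' : ∀ y ∈ l, y ∈ Submodule.span K s := fun z hz => hl z (by simp [hz])
    clear hl
    induction hy using Submodule.span_induction with
    | mem y hy =>
      have := ih (u ++ [y]) hl' (by
        intro z hz
        rcases List.mem_append.1 hz with hz | hz
        · exact hu z hz
        · rw [List.mem_singleton.1 hz]; exact hy)
      simpa using this
    | zero => rw [hF.map_zero]; exact W.zero_mem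
    | add y y' _ _ hy hy' => rw [hF.map_add]; exact W.add_mem hy hy'
    | smul c y _ hy => rw [hF.map_smul]; exact W.smul_mem c hy

theorem IsMultilinear.eq_of_span {F G : List A → N} (hF : IsMultilinear K F)
    (hG : IsMultilinear K G) {s : Set A} (hs : Submodule.span K s = ⊤)
    (h : ∀ l : List A, (∀ y ∈ l, y ∈ s) → F l = G l) (l : List A) : F l = G l := by
  have hFG : IsMultilinear K fun l => F l - G l := by
    intro c u y y' v
    simp only [hF c, hG c]
    module
  have := hFG.mem_of_span (W := ⊥) (s := s)
    (fun l hl => by simpa [sub_eq_zero] using h l hl) l (fun y _ => by rw [hs]; trivial)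
  simpa [sub_eq_zero] using this

theorem sumSplits_mem {A : Type*} {W : Submodule K N}
    {F : List A → List A → N} {l : List A} (h : ∀ u v, u ++ v = l → F u v ∈ W) :
    sumSplits F l ∈ W := by
  induction l generalizing F with
  | nil => exact h _ _ rfl
  | cons a l ih =>
    exact W.add_mem (h _ _ rfl) (ih fun u v huv => h _ _ (by rw [← huv]; rfl))

theorem braceWord_mem {W : Submodule K N}
    {W' : Submodule K A} {M : A → List A → A} {F : List A → N} {ys zs : List A}
    (hF : ∀ l, (∀ y ∈ l, y ∈ W') → F l ∈ W)
    (hy : ∀ y ∈ ys, ∀ l, (∀ z ∈ l, z ∈ W') → M y l ∈ W') (hz : ∀ z ∈ zs, z ∈ W') :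
    braceWord M F ys zs ∈ W := by
  induction ys generalizing F zs with
  | nil => exact hF _ hz
  | cons y ys ih =>
    refine sumSplits_mem fun u v huv => sumSplits_mem fun v₁ v₂ hv => ?_
    have hz' : ∀ z, z ∈ u ∨ z ∈ v₁ ∨ z ∈ v₂ → z ∈ W' := by
      intro z h
      apply hz
      rw [← huv, ← hv]
      simpa using h
    refine ih (fun l hl => hF _ ?_) (fun y' hy' => hy y' (by simp [hy']))
      fun z h => hz' z (Or.inr (Or.inr h))
    intro z h
    rcases List.mem_append.1 h with h | h
    · exact hz' z (Or.inl h)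
    rcases List.mem_cons.1 h with rfl | h
    · exact hy y (by simp) _ fun z h => hz' z (Or.inr (Or.inl h))
    · exact hl z h

end Multilinear

namespace Tridend

section GV

variable {K : Type*} [CommRing K] {X : Type*} (q : K)

/-! ### The relations of `GV` algebras for primitive elements -/

theorem isMultilinear_omegaPrec : IsMultilinear K (omegaPrec q : List (Plus K X) → Plus K X) := by
  intro c u y y' v
  induction u with
  | nil => simp
  | cons a u ih => simp only [List.cons_append, omegaPrec_cons, ih, map_add, map_smul]

theorem foldl_succTilde_linear (c : K) (a a' : Plus K X) (l : List (Plus K X)) :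
    l.foldl (fun a y => succTilde q a y) (c • a + a') =
      c • l.foldl (fun a y => succTilde q a y) a + l.foldl (fun a y => succTilde q a y) a' := by
  induction l generalizing a a' with
  | nil => rfl
  | cons y l ih =>
    simp only [List.foldl_cons, ← ih, map_add, map_smul, LinearMap.add_apply, LinearMap.smul_apply]

theorem isMultilinear_omegaSucc : IsMultilinear K (omegaSucc q : List (Plus K X) → Plus K X) := by
  intro c u y y' v
  simp only [omegaSucc, List.foldl_append, List.foldl_cons, map_add, map_smul,
    foldl_succTilde_linear]

theorem isMultilinear_braceOp (x : Plus K X) : IsMultilinear K (braceOp q x) := by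
  have h : braceOp q x = sumSplits (fun u v => (-1 : K) ^ v.length •
      prec q (succTilde q (omegaPrec q u) x) (omegaSucc q v)) := by
    funext l; exact braceOp_eq_sumSplits q x l
  rw [h]
  refine IsMultilinear.sumSplits (fun v => ?_) fun u => ?_
  · exact (isMultilinear_omegaPrec q).comp ((-1 : K) ^ v.length •
      (prec q).flip (omegaSucc q v) ∘ₗ (succTilde q).flip x)
  · intro c a y y' b
    simp only [isMultilinear_omegaSucc q c, List.length_append, List.length_cons, map_add, map_smul]
    module

theorem braceOp_add_left (x x' : Plus K X) (l : List (Plus K X)) :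
    braceOp q (x + x') l = braceOp q x l + braceOp q x' l := by
  simp only [braceOp, ← Finset.sum_add_distrib, map_add, LinearMap.add_apply, smul_add]

theorem braceOp_smul_left (c : K) (x : Plus K X) (l : List (Plus K X)) :
    braceOp q (c • x) l = c • braceOp q x l := by
  simp only [braceOp, Finset.smul_sum, map_smul, LinearMap.smul_apply, smul_comm c]

/-- The product `·` of primitive elements. -/
def primMul : Prim X q →ₗ[K] Prim X q →ₗ[K] Prim X q :=
  LinearMap.mk₂ K (fun x y => ⟨dot q (x : Plus K X) (y : Plus K X),
      dot_mem_Prim (q := q) (a := (x : Plus K X)) (b := (y : Plus K X)) x.2 y.2⟩)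
    (fun x x' y => Subtype.ext (LinearMap.map_add₂ (dot q) (x : Plus K X) x' y))
    (fun c x y => Subtype.ext (LinearMap.map_smul₂ (dot q) c (x : Plus K X) y))
    (fun x y y' => Subtype.ext (map_add (dot q (x : Plus K X)) (y : Plus K X) y'))
    (fun c x y => Subtype.ext (map_smul (dot q (x : Plus K X)) c (y : Plus K X)))

/-- The brace operations on primitive elements. -/
def primBrace (x : Prim X q) (l : List (Prim X q)) : Prim X q :=
  ⟨braceOp q x (l.map (↑)), braceOp_mem_Prim x.2 (by simp +contextual)⟩

/-- The operator `a ↦ z₁ · (z₂ · (⋯ (zₙ · a)))` for primitive elements `z₁, …, zₙ`. -/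
def dotList : List (Prim X q) → Module.End K (Plus K X)
  | [] => LinearMap.id
  | z :: l => dot q (z : Plus K X) ∘ₗ dotList l

/-- The element `ω_≺(y₁, …, yₙ)` for primitive elements `y₁, …, yₙ`. -/
def primOmega (l : List (Prim X q)) : Plus K X := omegaPrec q (l.map (↑))

variable {q}

@[simp] theorem coe_primMul (x y : Prim X q) :
    (primMul q x y : Plus K X) = dot q (x : Plus K X) y := rfl

theorem coe_primBrace (x : Prim X q) (l : List (Prim X q)) :
    (primBrace q x l : Plus K X) = braceOp q (x : Plus K X) (l.map (↑)) := rfl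

@[simp] theorem primOmega_nil : primOmega q ([] : List (Prim X q)) = one := rfl

@[simp] theorem primOmega_cons (y : Prim X q) (l : List (Prim X q)) :
    primOmega q (y :: l) = prec q y (primOmega q l) := rfl

theorem counit_prim (x : Prim X q) : counit (x : Plus K X) = 0 := counit_of_mem_Prim x.2

/-- The identity `succTilde_omegaPrec` for primitive elements. -/
theorem succTilde_primOmega (x : Prim X q) (l : List (Prim X q)) :
    succTilde q (primOmega q l) x =
      sumSplits (fun u v => prec q (primBrace q x u : Plus K X) (primOmega q v)) l := by
  rw [primOmega, succTilde_omegaPrec, sumSplits_map]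
  · rfl
  · intro y hy
    obtain ⟨z, -, rfl⟩ := List.mem_map.1 hy
    exact counit_prim z

/-- The map `(y₁, …, yₙ) ↦ ω_≺(y₁, …, yₙ)` takes the product of words of the brace algebra to `*`. -/
theorem primOmega_starProd (ys zs : List (Prim X q)) :
    starProd q (primOmega q zs) (primOmega q ys) =
      braceWord (primBrace q) (primOmega q) ys zs := by
  induction ys generalizing zs with
  | nil => simp [braceWord]
  | cons y ys ih =>
    have key : ∀ zs : List (Prim X q),
        sumSplits (fun v₁ v₂ => braceWord (primBrace q)
          (fun l => primOmega q ([] ++ primBrace q y v₁ :: l)) ys v₂) zs =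
        prec q (succTilde q (primOmega q zs) y) (primOmega q ys) := by
      intro zs
      rw [succTilde_primOmega, ← LinearMap.flip_apply, map_sumSplits]
      refine sumSplits_congr' _ fun u v => ?_
      simp only [List.nil_append, primOmega_cons]
      rw [← map_braceWord (prec q (primBrace q y u : Plus K X)), ← ih, LinearMap.flip_apply,
        prec_prec]
    induction zs with
    | nil =>
      rw [braceWord, sumSplits, key, primOmega_nil, one_starProd, one_succTilde q (counit_prim y),
        primOmega_cons]
    | cons z zs ih' =>
      rw [braceWord, sumSplits, key, primOmega_cons, starProd_eq_left q (counit_prec q _ _),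
        prec_prec, ih', braceWord, primOmega_cons y ys, succTilde_prec, add_comm]
      congr 1
      simp only [map_sumSplits, List.cons_append, primOmega_cons]
      refine sumSplits_congr' _ fun u v => sumSplits_congr' _ fun v₁ v₂ => ?_
      exact map_braceWord _ _ _ _ _

/-- The brace relation. It follows by induction from the identity
`ω_≺(z) ≻ (ω_≺(y) ≻ x) = (ω_≺(z) * ω_≺(y)) ≻ x`, where `≻` stands for `q · + ≻`. -/
theorem primBrace_primBrace (x : Prim X q) (ys zs : List (Prim X q)) :
    primBrace q (primBrace q x ys) zs = braceWord (primBrace q) (primBrace q x) ys zs := by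
  let D : List (Prim X q) → List (Prim X q) → Plus K X := fun ys zs =>
    (primBrace q (primBrace q x ys) zs : Plus K X) -
      (braceWord (primBrace q) (primBrace q x) ys zs : Prim X q)
  -- the associativity of `*`, expanded in two ways
  have h : ∀ ys zs : List (Prim X q), sumSplits (fun y₁ y₂ => sumSplits (fun z₁ z₂ =>
      prec q (D y₁ z₁) (starProd q (primOmega q z₂) (primOmega q y₂))) zs) ys = 0 := by
    intro ys zs
    simp only [D, map_sub, LinearMap.sub_apply, sumSplits_sub]
    rw [sub_eq_zero]
    trans succTilde q (primOmega q zs) (succTilde q (primOmega q ys) x)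
    · rw [succTilde_primOmega, map_sumSplits]
      refine sumSplits_congr' _ fun u v => ?_
      rw [← succTilde_prec, succTilde_primOmega, ← LinearMap.flip_apply, map_sumSplits]
      refine sumSplits_congr' _ fun a b => ?_
      rw [LinearMap.flip_apply, prec_prec]
    · rw [succTilde_succTilde, primOmega_starProd, ← LinearMap.flip_apply, map_braceWord]
      simp only [LinearMap.flip_apply, succTilde_primOmega]
      rw [braceWord_deconcatenation]
      refine sumSplits_congr' _ fun u v => sumSplits_congr' _ fun a b => ?_
      rw [primOmega_starProd, ← LinearMap.flip_apply (prec q), ← Submodule.subtype_apply,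
        map_braceWord, map_braceWord, map_braceWord]
      congr 1
      funext l
      exact (map_braceWord (LinearMap.applyₗ (R := K) (primBrace q x l : Plus K X))
        (primBrace q) (fun l => (prec q).flip (primOmega q l)) v b).symm
  have hD : D ys zs = 0 := by
    induction hn : ys.length + zs.length using Nat.strong_induction_on generalizing ys zs with
    | _ n ih =>
      have hc : counit (D ys zs) = 0 := by simp [D, counit_prim]
      have h' := h ys zs
      rw [sumSplits_eq_last, sumSplits_eq_last] at h'
      · simpa [prec_one q hc] using h'
      · intro u v huv hv
        have := List.length_pos_iff.mpr hv
        rw [ih (ys.length + u.length) (by rw [← hn, ← huv, List.length_append]; omega) _ _ rfl]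
        simp
      · intro u v huv hv
        have := List.length_pos_iff.mpr hv
        refine Eq.trans (sumSplits_congr fun a b hab => ?_) (sumSplits_zero zs)
        rw [ih (u.length + a.length) (by
          rw [← hn, ← huv, ← hab, List.length_append, List.length_append]; omega) _ _ rfl]
        simp
  exact Subtype.ext (sub_eq_zero.1 hD)

theorem dotList_prec (b : List (Prim X q)) (w c : Plus K X) :
    prec q (dotList q b w) c = dotList q b (prec q w c) := by
  induction b with
  | nil => rfl
  | cons z b ih => rw [dotList, LinearMap.comp_apply, LinearMap.comp_apply, dot_prec, ih]

theorem coe_foldr_primMul (b : List (Prim X q)) (w : Prim X q) :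
    ((b.foldr (fun z a => primMul q z a) w : Prim X q) : Plus K X) = dotList q b w := by
  induction b with
  | nil => rfl
  | cons z b ih => rw [List.foldr_cons, coe_primMul, ih]; rfl

/-- The expansion of `ω_≺(z₁, …, zₙ) ≻ y` in terms of `q · + ≻`. -/
theorem succ_primOmega (y : Prim X q) (zs : List (Prim X q)) :
    succ q (primOmega q zs) (y : Plus K X) = sumSplits (fun b r => (-q) ^ b.length •
      dotList q b (succTilde q (primOmega q r) (y : Plus K X))) zs := by
  induction zs with
  | nil => simp [sumSplits, dotList, one_succ q (counit_prim y), one_succTilde q (counit_prim y)]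
  | cons z zs ih =>
    rw [sumSplits]
    have h := congrArg (fun a => (-q) • dot q (z : Plus K X) a) ih
    simp only [map_sumSplits, smul_sumSplits, map_smul, smul_smul] at h
    simp only [List.length_cons, pow_succ', dotList, LinearMap.comp_apply, ← h]
    rw [← prec_dot, List.length_nil, LinearMap.id_apply, succTilde_apply, primOmega_cons]
    module

/-- The distributive relation. It follows by induction from the identity
`ω_≺(z) ≻ (x · y) = (ω_≺(z) ≻ x) · y`, where `≻` stands for `q · + ≻`. -/
theorem primBrace_primMul (x y : Prim X q) (zs : List (Prim X q)) :
    primBrace q (primMul q x y) zs = sumSplits (fun a v => sumSplits (fun b c =>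
      (-q) ^ b.length • primMul q (primBrace q x a)
        (b.foldr (fun z a => primMul q z a) (primBrace q y c))) v) zs := by
  let D : List (Prim X q) → Plus K X := fun zs =>
    (primBrace q (primMul q x y) zs : Plus K X) - ((sumSplits (fun a v => sumSplits (fun b c =>
      (-q) ^ b.length • primMul q (primBrace q x a)
        (b.foldr (fun z a => primMul q z a) (primBrace q y c))) v) zs : Prim X q) : Plus K X)
  suffices hD : D zs = 0 from Subtype.ext (sub_eq_zero.1 hD)
  refine eq_zero_of_sumSplits (fun u v => prec q u (primOmega q v)) (by simp)
    (fun l => prec_one q (by simp [D, counit_prim])) (fun l => ?_) zs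
  -- `ω_≺(z) ≻ (x · y)`, where `≻` stands for `q · + ≻`, expanded in two ways
  simp only [D, map_sub, LinearMap.sub_apply, sumSplits_sub]
  rw [sub_eq_zero, ← succTilde_primOmega, coe_primMul, ← succTilde_dot, succTilde_primOmega,
    ← LinearMap.flip_apply (dot q), map_sumSplits]
  refine Eq.trans ?_ ((sumSplits_assoc₃ (fun a b c d => (-q) ^ b.length •
    dot q (primBrace q x a : Plus K X) (dotList q b
      (prec q (primBrace q y c : Plus K X) (primOmega q d)))) l).symm.trans ?_)
  · refine sumSplits_congr' _ fun a v => ?_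
    rw [LinearMap.flip_apply, prec_dot, succ_primOmega, map_sumSplits]
    refine sumSplits_congr' _ fun b w => ?_
    rw [succTilde_primOmega, map_sumSplits, map_smul, map_sumSplits, smul_sumSplits]
  · refine sumSplits_congr' _ fun w d => ?_
    rw [← LinearMap.flip_apply (prec q), ← Submodule.subtype_apply, map_sumSplits, map_sumSplits]
    refine sumSplits_congr' _ fun a v => ?_
    rw [map_sumSplits, map_sumSplits]
    refine sumSplits_congr' _ fun b c => ?_
    rw [map_smul, map_smul, LinearMap.flip_apply, Submodule.subtype_apply, coe_primMul, dot_prec,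
      coe_foldr_primMul, dotList_prec]

variable (X q)

/-- The primitive elements form a `GV_{-q}` algebra. -/
def primGV : GVAlgebra (-q) (Prim X q) where
  mul := primMul q
  mul_assoc x y z := Subtype.ext (dot_assoc q _ _ _)
  brace := primBrace q
  brace_add_left x x' l := Subtype.ext (braceOp_add_left q _ _ _)
  brace_smul_left c x l := Subtype.ext (braceOp_smul_left q c _ _)
  brace_add x u y y' v := Subtype.ext (by
    have := (isMultilinear_braceOp q (x : Plus K X)).map_add (u.map (↑)) y y' (v.map (↑))
    simpa [coe_primBrace] using this)
  brace_smul c x u y v := Subtype.ext (by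
    have := (isMultilinear_braceOp q (x : Plus K X)).map_smul c (u.map (↑)) y (v.map (↑))
    simpa [coe_primBrace] using this)
  brace_nil x := Subtype.ext (braceOp_nil q (counit_prim x))
  brace_brace x ys zs := by
    rw [primBrace_primBrace, braceSum_eq_braceWord]
    rfl
  brace_mul x y zs := by
    rw [primBrace_primMul]
    exact (sum_range_Icc_sub_eq_sumSplits (fun n a b c => (-q) ^ n • primMul q (primBrace q x a)
      (b.foldr (fun z a => primMul q z a) (primBrace q y c))) zs).symm

end GV

end Tridend

/-! ### Normal forms in a `GV_q` algebra -/

namespace GVAlgebra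

open Tridend

variable {K : Type*} [CommRing K] {q : K} {A : Type*} [AddCommGroup A] [Module K A]

theorem isMultilinear_brace (S : GVAlgebra q A) (x : A) : IsMultilinear K (S.brace x) := by
  intro c u y y' v
  rw [S.brace_add, S.brace_smul]

theorem brace_brace' (S : GVAlgebra q A) (x : A) (ys zs : List A) :
    S.brace (S.brace x ys) zs = braceWord S.brace (S.brace x) ys zs := by
  rw [S.brace_brace, braceSum_eq_braceWord]
  rfl

theorem brace_mul' (S : GVAlgebra q A) (x y : A) (zs : List A) :
    S.brace (S.mul x y) zs = sumSplits (fun a v => sumSplits (fun b c =>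
      q ^ b.length • S.mul (S.brace x a) (b.foldr (fun z a => S.mul z a) (S.brace y c))) v) zs := by
  rw [S.brace_mul]
  exact sum_range_Icc_sub_eq_sumSplits (fun n a b c => q ^ n • S.mul (S.brace x a)
    (b.foldr (fun z a => S.mul z a) (S.brace y c))) zs

theorem brace_zero_left (S : GVAlgebra q A) (ys : List A) : S.brace 0 ys = 0 := by
  simpa using S.brace_smul_left 0 0 ys

variable {X : Type*}

mutual

/-- The normal form `M(x₁; t¹) · ⋯ · M(x_s; t^s)` indexed by `[(x₁, t¹), …, (x_s, t^s)]`, where a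
tree `t` stands for the list of the normal forms indexed by the lists of branches at the vertices
on its leftmost path. -/
def normalForm (S : GVAlgebra q A) (f : X → A) : Branches X → A
  | .single x t => S.brace (f x) (normalForms S f t)
  | .cons x t bs => S.mul (S.brace (f x) (normalForms S f t)) (normalForm S f bs)

/-- The list of the normal forms indexed by the lists of branches at the vertices on the leftmost
path of a tree. -/
def normalForms (S : GVAlgebra q A) (f : X → A) : PTree X → List A
  | .leaf => []
  | .node t bs => normalForm S f bs :: normalForms S f t

end

/-- The tree with given lists of branches at the vertices on its leftmost path. -/
def _root_.Tridend.PTree.ofList (l : List (Branches X)) : PTree X :=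
  l.foldr (fun bs t => .node t bs) .leaf

variable (S : GVAlgebra q A) (f : X → A)

theorem normalForms_ofList (l : List (Branches X)) :
    S.normalForms f (PTree.ofList l) = l.map (S.normalForm f) := by
  induction l with
  | nil => rw [PTree.ofList, List.foldr_nil, normalForms, List.map_nil]
  | cons b l ih => rw [PTree.ofList, List.foldr_cons, normalForms, List.map_cons, ← ih]; rfl

theorem exists_normalForms_eq {l : List A} (hl : ∀ y ∈ l, y ∈ Set.range (S.normalForm f)) :
    ∃ t, l = S.normalForms f t := by
  obtain ⟨c, rfl⟩ : l ∈ Set.range (List.map (S.normalForm f)) := by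
    rw [Set.range_list_map]; exact hl
  exact ⟨PTree.ofList c, (S.normalForms_ofList f c).symm⟩

theorem mul_normalForm (bs cs : Branches X) :
    S.mul (S.normalForm f bs) (S.normalForm f cs) = S.normalForm f (bs.append cs) := by
  match bs with
  | .single x t => rw [Branches.append, normalForm, normalForm]
  | .cons x t bs => rw [Branches.append, normalForm, normalForm, S.mul_assoc, mul_normalForm bs cs]

/-- Induction along the construction of normal forms. -/
theorem normalForm_induction {P : A → Prop}
    (h1 : ∀ x t, (∀ y ∈ S.normalForms f t, P y) → P (S.brace (f x) (S.normalForms f t)))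
    (h2 : ∀ x y, P x → P y → P (S.mul x y)) (bs : Branches X) : P (S.normalForm f bs) := by
  induction bs using Branches.rec (motive_1 := fun t => ∀ y ∈ S.normalForms f t, P y) with
  | leaf => rename_i y hy; rw [normalForms] at hy; simp at hy
  | node t bs ht hbs =>
    rename_i y hy
    rw [normalForms] at hy
    rcases List.mem_cons.1 hy with rfl | hy
    · exact hbs
    · exact ht y hy
  | single x t ht => rw [normalForm]; exact h1 x t ht
  | cons x t bs ht hbs => rw [normalForm]; exact h2 _ _ (h1 x t ht) hbs

/-! ### The span of the normal forms is a subalgebra -/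

theorem mul_mem_span_normalForm {x y : A} (hx : x ∈ Submodule.span K (Set.range (S.normalForm f)))
    (hy : y ∈ Submodule.span K (Set.range (S.normalForm f))) :
    S.mul x y ∈ Submodule.span K (Set.range (S.normalForm f)) := by
  refine Submodule.span_induction₂ (p := fun x y _ _ =>
    S.mul x y ∈ Submodule.span K (Set.range (S.normalForm f))) ?_ ?_ ?_ ?_ ?_ ?_ ?_ hx hy
  · rintro _ _ ⟨bs, rfl⟩ ⟨cs, rfl⟩
    rw [mul_normalForm]
    exact Submodule.subset_span ⟨_, rfl⟩
  · intro y _; rw [map_zero, LinearMap.zero_apply]; exact Submodule.zero_mem _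
  · intro y _; rw [map_zero]; exact Submodule.zero_mem _
  · intro x y z _ _ _ h h'; rw [map_add, LinearMap.add_apply]; exact Submodule.add_mem _ h h'
  · intro x y z _ _ _ h h'; rw [map_add]; exact Submodule.add_mem _ h h'
  · intro r x y _ _ h; rw [map_smul, LinearMap.smul_apply]; exact Submodule.smul_mem _ _ h
  · intro r x y _ _ h; rw [map_smul]; exact Submodule.smul_mem _ _ h

/-- The relations of `GV_q` algebras reduce any brace of normal forms to normal forms. -/
theorem brace_mem_span_normalForm {x : A} {zs : List A}
    (hx : x ∈ Submodule.span K (Set.range (S.normalForm f)))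
    (hz : ∀ z ∈ zs, z ∈ Submodule.span K (Set.range (S.normalForm f))) :
    S.brace x zs ∈ Submodule.span K (Set.range (S.normalForm f)) := by
  induction hx using Submodule.span_induction with
  | mem x hx =>
    obtain ⟨bs, rfl⟩ := hx
    refine S.normalForm_induction f (P := fun x => ∀ zs : List A,
      (∀ z ∈ zs, z ∈ Submodule.span K (Set.range (S.normalForm f))) →
      S.brace x zs ∈ Submodule.span K (Set.range (S.normalForm f))) ?_ ?_ bs zs hz
    · intro x t ht zs hz
      rw [brace_brace']
      refine braceWord_mem (fun l hl => ?_) ht hz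
      refine (S.isMultilinear_brace (f x)).mem_of_span (fun l hl => ?_) l hl
      obtain ⟨t', rfl⟩ := S.exists_normalForms_eq f hl
      exact Submodule.subset_span ⟨.single x t', by rw [normalForm]⟩
    · intro x y hx hy zs hz
      rw [brace_mul']
      refine sumSplits_mem fun u v huv => sumSplits_mem fun v₁ v₂ hv => Submodule.smul_mem _ _ ?_
      have hz' : ∀ z, z ∈ u ∨ z ∈ v₁ ∨ z ∈ v₂ →
          z ∈ Submodule.span K (Set.range (S.normalForm f)) := by
        intro z h
        apply hz
        rw [← huv, ← hv]
        simpa using h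
      refine S.mul_mem_span_normalForm f (hx u fun z h => hz' z (Or.inl h)) ?_
      have hv₁ := fun z h => hz' z (Or.inr (Or.inl h))
      have hv₂ := hy v₂ fun z h => hz' z (Or.inr (Or.inr h))
      clear hv huv hz'
      induction v₁ with
      | nil => exact hv₂
      | cons a l ih =>
        exact S.mul_mem_span_normalForm f (hv₁ a (by simp)) (ih fun z h => hv₁ z (by simp [h]))
  | zero => rw [brace_zero_left]; exact Submodule.zero_mem _
  | add x y _ _ hx hy => rw [S.brace_add_left]; exact Submodule.add_mem _ hx hy
  | smul c x _ hx => rw [S.brace_smul_left]; exact Submodule.smul_mem _ _ hx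

/-! ### Freeness from a basis of normal forms -/

variable {B : Type*} [AddCommGroup B] [Module K B] {S f} {T : GVAlgebra q B}

theorem IsHom.map_normalForm {g : A →ₗ[K] B} (hg : S.IsHom T g) (bs : Branches X) :
    g (S.normalForm f bs) = T.normalForm (fun x => g (f x)) bs := by
  induction bs using Branches.rec (motive_1 := fun t =>
    (S.normalForms f t).map g = T.normalForms (fun x => g (f x)) t) with
  | leaf => rw [normalForms, normalForms]; rfl
  | node t bs ht hbs => rw [normalForms, normalForms, List.map_cons, ht, hbs]
  | single x t ht => rw [normalForm, normalForm, hg.2, ht]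
  | cons x t bs ht hbs => rw [normalForm, normalForm, hg.1, hg.2, ht, hbs]

/-- A linear map which sends normal forms to normal forms is a homomorphism, provided the normal
forms span: the relations determine the braces of normal forms by recursion on the first argument. -/
theorem isHom_of_map_normalForm {f' : X → B} {g : A →ₗ[K] B}
    (hs : Submodule.span K (Set.range (S.normalForm f)) = ⊤)
    (hg : ∀ bs, g (S.normalForm f bs) = T.normalForm f' bs) : S.IsHom T g := by
  have hgT : ∀ t, (S.normalForms f t).map g = T.normalForms f' t := by
    intro t
    induction t using PTree.rec (motive_2 := fun _ => True) with
    | leaf => rw [normalForms, normalForms]; rfl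
    | node t bs ht _ => rw [normalForms, normalForms, List.map_cons, ht, hg]
    | single => trivial
    | cons => trivial
  have hmul : ∀ x y, g (S.mul x y) = T.mul (g x) (g y) := by
    intro x y
    have hx : x ∈ Submodule.span K (Set.range (S.normalForm f)) := by rw [hs]; trivial
    have hy : y ∈ Submodule.span K (Set.range (S.normalForm f)) := by rw [hs]; trivial
    refine Submodule.span_induction₂ (p := fun x y _ _ => g (S.mul x y) = T.mul (g x) (g y))
      ?_ ?_ ?_ ?_ ?_ ?_ ?_ hx hy
    · rintro _ _ ⟨bs, rfl⟩ ⟨cs, rfl⟩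
      rw [mul_normalForm, hg, hg, hg, mul_normalForm]
    · simp
    · simp
    · intro x y z _ _ _ h h'; simp only [map_add, LinearMap.add_apply, h, h']
    · intro x y z _ _ _ h h'; simp only [map_add, h, h']
    · intro r x y _ _ h; simp only [map_smul, LinearMap.smul_apply, h]
    · intro r x y _ _ h; simp only [map_smul, h]
  have hgen : ∀ x zs, g (S.brace (f x) zs) = T.brace (f' x) (zs.map g) := by
    intro x zs
    refine ((S.isMultilinear_brace (f x)).comp g).eq_of_span
      (G := fun zs => T.brace (f' x) (zs.map g)) ?_ hs ?_ zs
    · intro c u y y' v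
      simp only [List.map_append, List.map_cons, map_add, map_smul]
      exact T.isMultilinear_brace (f' x) c _ _ _ _
    · intro l hl
      obtain ⟨t, rfl⟩ := S.exists_normalForms_eq f hl
      have := hg (.single x t)
      rw [normalForm, normalForm] at this
      rw [this, hgT]
  have hbr : ∀ bs zs, g (S.brace (S.normalForm f bs) zs) =
      T.brace (g (S.normalForm f bs)) (zs.map g) := by
    refine S.normalForm_induction f (P := fun x => ∀ zs : List A,
      g (S.brace x zs) = T.brace (g x) (zs.map g)) ?_ ?_
    · intro x t ht zs
      rw [brace_brace', hgen, brace_brace']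
      exact map_braceWord_list g.toAddMonoidHom g _ _ (hgen x) ht
    · intro x y hx hy zs
      rw [brace_mul', hmul, brace_mul']
      refine map_sumSplits_list g.toAddMonoidHom g _ fun a v _ =>
        map_sumSplits_list g.toAddMonoidHom g _ fun b c hbc => ?_
      clear hbc
      change g _ = _
      rw [map_smul, hmul, hx, List.length_map]
      congr 2
      induction b with
      | nil => exact hy c
      | cons z b ih => rw [List.foldr_cons, hmul, ih, List.map_cons, List.foldr_cons]
  refine ⟨hmul, fun x zs => ?_⟩
  have hx : x ∈ Submodule.span K (Set.range (S.normalForm f)) := by rw [hs]; trivial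
  induction hx using Submodule.span_induction with
  | mem x hx => obtain ⟨bs, rfl⟩ := hx; exact hbr bs zs
  | zero => rw [brace_zero_left, map_zero, brace_zero_left]
  | add x y _ _ hx hy => rw [S.brace_add_left, map_add, map_add, T.brace_add_left, hx, hy]
  | smul c x _ hx => rw [S.brace_smul_left, map_smul, map_smul, T.brace_smul_left, hx]

/-- A `GV_q` algebra with a basis of normal forms is free. -/
theorem isFree_of_basis {V : Type*} [AddCommGroup V] [Module K V] (b : Module.Basis X K V)
    (j : V →ₗ[K] A) (hj : ∀ x, j (b x) = f x) (e : Module.Basis (Branches X) K A)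
    (he : ∀ bs, e bs = S.normalForm f bs) : IsFree.{w} S j := by
  intro B _ _ T φ
  have hs : Submodule.span K (Set.range (S.normalForm f)) = ⊤ := by
    rw [← e.span_eq]
    congr 2
    funext bs
    exact (he bs).symm
  refine ⟨e.constr K fun bs => T.normalForm (fun x => φ (b x)) bs, ⟨?_, ?_⟩, ?_⟩
  · refine isHom_of_map_normalForm (f := f) (f' := fun x => φ (b x)) hs fun bs => ?_
    rw [← he, Module.Basis.constr_basis]
  · refine b.ext fun x => ?_
    have h : f x = S.normalForm f (.single x .leaf) := by
      rw [normalForm, normalForms, S.brace_nil]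
    rw [LinearMap.comp_apply, hj, h, ← he, Module.Basis.constr_basis, normalForm, normalForms,
      T.brace_nil]
  · rintro g ⟨hg, rfl⟩
    refine e.ext fun bs => ?_
    rw [Module.Basis.constr_basis, he, hg.map_normalForm]
    simp only [LinearMap.comp_apply, hj]

/-! ### The change of sign of the brace operations -/

variable (S) in
/-- Multiplying the operations `M_{1n}` by `(-1)ⁿ` turns `GV_q` algebras into `GV_{-q}` algebras. -/
def twist {q' : K} (h : q' = -q) : GVAlgebra q' A where
  mul := S.mul
  mul_assoc := S.mul_assoc
  brace x l := (-1 : K) ^ l.length • S.brace x l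
  brace_add_left x x' l := by rw [S.brace_add_left, smul_add]
  brace_smul_left c x l := by rw [S.brace_smul_left, smul_comm]
  brace_add x u y y' v := by simp only [S.brace_add, smul_add, List.length_append, List.length_cons]
  brace_smul c x u y v := by
    simp only [S.brace_smul, List.length_append, List.length_cons, smul_comm c]
  brace_nil x := by simp [S.brace_nil]
  brace_brace x ys zs := by
    rw [braceSum_eq_braceWord, S.brace_smul_left, brace_brace', smul_smul]
    suffices h : ∀ (F : List A → A) (n : ℕ) (zs : List A), IsMultilinear K F →
        braceWord (fun x l => (-1 : K) ^ l.length • S.brace x l)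
          (fun l => (-1 : K) ^ (n + l.length) • F l) ys zs =
        (-1 : K) ^ (n + zs.length + ys.length) • braceWord S.brace F ys zs by
      have := h (S.brace x) 0 zs (S.isMultilinear_brace x)
      simpa [pow_add] using this.symm
    induction ys with
    | nil => intro F n zs hF; rfl
    | cons y ys ih =>
      intro F n zs hF
      simp only [braceWord, smul_sumSplits]
      refine sumSplits_congr fun u v huv => sumSplits_congr fun v₁ v₂ hv => ?_
      have h' : IsMultilinear K fun l => F (u ++ S.brace y v₁ :: l) := by
        intro c a z z' b
        have := hF c (u ++ S.brace y v₁ :: a) z z' b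
        simpa using this
      have h := ih _ (n + u.length + 1 + v₁.length) v₂ h'
      rw [← huv, ← hv]
      simp only [List.length_append, List.length_cons]
      refine Eq.trans ?_ (h.trans ?_)
      · congr 1
        funext l
        rw [hF.map_smul, smul_smul, ← pow_add]
        congr 2
        omega
      · congr 2
        omega
  brace_mul x y zs := by
    refine Eq.trans ?_ (sum_range_Icc_sub_eq_sumSplits (fun n a b c => q' ^ n •
      S.mul ((-1 : K) ^ a.length • S.brace x a) (b.foldr (fun z a => S.mul z a)
        ((-1 : K) ^ c.length • S.brace y c))) zs).symm
    rw [brace_mul', smul_sumSplits]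
    refine sumSplits_congr fun a v hav => ?_
    rw [smul_sumSplits]
    refine sumSplits_congr fun b c hbc => ?_
    have hf : ∀ w, b.foldr (fun z a => S.mul z a) ((-1 : K) ^ c.length • w) =
        (-1 : K) ^ c.length • b.foldr (fun z a => S.mul z a) w := by
      intro w
      clear hbc
      induction b with
      | nil => rfl
      | cons z b ih => rw [List.foldr_cons, List.foldr_cons, ih, map_smul]
    rw [hf, map_smul, map_smul, LinearMap.smul_apply, smul_smul, smul_smul, smul_smul, h, ← hav,
      ← hbc, List.length_append, List.length_append, neg_pow q]
    congr 1
    ring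

theorem isHom_twist {q' : K} (h : q' = -q) {T : GVAlgebra q' B} {h' : q = -q'} {g : A →ₗ[K] B} :
    (S.twist h).IsHom T g ↔ S.IsHom (T.twist h') g := by
  refine and_congr Iff.rfl (forall_congr' fun x => forall_congr' fun l => ?_)
  change g ((-1 : K) ^ l.length • _) = _ ↔ _ = (-1 : K) ^ (l.map g).length • _
  have h1 : (-1 : K) ^ l.length * (-1 : K) ^ l.length = 1 := by
    rw [← mul_pow]; simp
  rw [List.length_map, map_smul]
  constructor
  · intro h
    rw [← h, smul_smul, h1, one_smul]
  · intro h
    rw [h, smul_smul, h1, one_smul]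

theorem IsFree.twist {q' : K} (h : q' = -q) {V : Type*} [AddCommGroup V] [Module K V]
    {j : V →ₗ[K] A} (hS : IsFree.{w} S j) : IsFree.{w} (S.twist h) j := by
  intro B _ _ T φ
  have h' : q = -q' := by rw [h, neg_neg]
  simpa only [isHom_twist h (h' := h')] using hS B (T.twist h') φ

end GVAlgebra

/-! ### Surjective graded endomorphisms with finite components -/

/-- A surjective graded endomorphism of a free module is injective if the components are
finitely generated. -/
theorem injective_of_surjective_of_graded {K T D : Type*} [CommRing K] (deg : T → D)
    (hfin : ∀ d, {t | deg t = d}.Finite) (Φ : (T →₀ K) →ₗ[K] (T →₀ K))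
    (hΦ : ∀ t t', Φ (Finsupp.single t 1) t' ≠ 0 → deg t' = deg t)
    (hsurj : Function.Surjective Φ) : Function.Injective Φ := by
  rw [injective_iff_map_eq_zero]
  intro z hz
  suffices h : ∀ d, Finsupp.lsubtypeDomain (R := K) {t | deg t = d} z = 0 by
    ext t
    exact DFunLike.congr_fun (h (deg t)) ⟨t, rfl⟩
  intro d
  let R : (T →₀ K) →ₗ[K] ({t | deg t = d} →₀ K) := Finsupp.lsubtypeDomain {t | deg t = d}
  let E : ({t | deg t = d} →₀ K) →ₗ[K] (T →₀ K) := Finsupp.lmapDomain K K Subtype.val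
  have hR : ∀ x (s : {t | deg t = d}), R x s = x s := fun _ _ => rfl
  have hRE : ∀ y, R (E y) = y := by
    intro y
    ext s
    exact (hR _ s).trans (Finsupp.mapDomain_apply Subtype.val_injective y s)
  have hcomm : ∀ x, R (Φ (E (R x))) = R (Φ x) := by
    intro x
    suffices h : R ∘ₗ Φ ∘ₗ E ∘ₗ R = R ∘ₗ Φ from LinearMap.congr_fun h x
    refine Finsupp.lhom_ext' fun t => LinearMap.ext_ring ?_
    change R (Φ (E (R (Finsupp.single t 1)))) = R (Φ (Finsupp.single t 1))
    by_cases ht : deg t = d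
    · have hE : E (Finsupp.single ⟨t, ht⟩ 1) = Finsupp.single t 1 := Finsupp.mapDomain_single
      rw [← hE, hRE]
    · have h1 : R (Finsupp.single t 1) = 0 := by
        ext ⟨t', ht'⟩
        have : t ≠ t' := fun h => ht (h ▸ ht')
        rw [hR]
        simp [this]
      have h2 : R (Φ (Finsupp.single t 1)) = 0 := by
        ext ⟨t', ht'⟩
        by_contra h
        exact ht ((hΦ t t' h).symm.trans ht')
      rw [h1, h2, map_zero, map_zero, map_zero]
  have : Finite {t | deg t = d} := hfin d
  have hinj : Function.Injective (R ∘ₗ Φ ∘ₗ E) := by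
    refine OrzechProperty.injective_of_surjective_endomorphism _ fun y => ?_
    obtain ⟨x, hx⟩ := hsurj (E y)
    exact ⟨R x, by change R (Φ (E (R x))) = y; rw [hcomm, hx, hRE]⟩
  refine hinj (Eq.trans ?_ (LinearMap.map_zero (R ∘ₗ Φ ∘ₗ E)).symm)
  change R (Φ (E (R z))) = 0
  rw [hcomm, hz, LinearMap.map_zero]

namespace Tridend

/-! ### The grading by the multiset of decorations -/

section Degree

variable {X : Type*}

mutual

/-- The multiset of the decorations of a tree. -/
def PTree.deg : PTree X → Multiset X
  | .leaf => 0
  | .node t bs => t.deg + bs.deg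

/-- The multiset of the decorations of a list of branches. -/
def Branches.deg : Branches X → Multiset X
  | .single x t => {x} + t.deg
  | .cons x t bs => {x} + t.deg + bs.deg

end

theorem Branches.deg_append (bs cs : Branches X) : (bs.append cs).deg = bs.deg + cs.deg := by
  match bs with
  | .single x t => rw [Branches.append, Branches.deg, Branches.deg]
  | .cons x t bs =>
    rw [Branches.append, Branches.deg, Branches.deg, Branches.deg_append bs cs]; abel

theorem Branches.deg_card_pos (bs : Branches X) : 0 < bs.deg.card := by
  cases bs <;> rw [Branches.deg] <;> simp

/-- There are finitely many trees and lists of branches with at most `n` decorations, all of them in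
a finite set. -/
theorem finite_deg_le (Y : Set X) (hY : Y.Finite) (n : ℕ) :
    {t : PTree X | t.deg.card ≤ n ∧ ∀ x ∈ t.deg, x ∈ Y}.Finite ∧
      {bs : Branches X | bs.deg.card ≤ n ∧ ∀ x ∈ bs.deg, x ∈ Y}.Finite := by
  induction n with
  | zero =>
    constructor
    · refine (Set.finite_singleton PTree.leaf).subset ?_
      rintro (_ | ⟨t, bs⟩) ⟨h, -⟩
      · rfl
      · have := bs.deg_card_pos
        rw [PTree.deg, Multiset.card_add] at h
        omega
    · refine Set.finite_empty.subset ?_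
      rintro bs ⟨h, -⟩
      have := bs.deg_card_pos
      omega
  | succ n ih =>
    obtain ⟨ihT, ihB⟩ := ih
    have hB : {bs : Branches X | bs.deg.card ≤ n + 1 ∧ ∀ x ∈ bs.deg, x ∈ Y}.Finite := by
      refine ((Set.Finite.image2 Branches.single hY ihT).union
        (Set.Finite.image2 (fun (p : X × PTree X) bs => Branches.cons p.1 p.2 bs)
          (hY.prod ihT) ihB)).subset ?_
      rintro (⟨x, t⟩ | ⟨x, t, bs⟩) ⟨h, h'⟩
      · rw [Branches.deg] at h h'
        simp only [Multiset.card_add, Multiset.card_singleton, Multiset.mem_add,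
          Multiset.mem_singleton] at h h'
        exact Or.inl ⟨x, h' x (Or.inl rfl), t, ⟨by omega, fun y hy => h' y (Or.inr hy)⟩, rfl⟩
      · rw [Branches.deg] at h h'
        simp only [Multiset.card_add, Multiset.card_singleton, Multiset.mem_add,
          Multiset.mem_singleton] at h h'
        exact Or.inr ⟨(x, t), ⟨h' x (Or.inl (Or.inl rfl)), ⟨by dsimp only; omega, fun y hy =>
          h' y (Or.inl (Or.inr hy))⟩⟩, bs, ⟨by omega, fun y hy => h' y (Or.inr hy)⟩, rfl⟩
    refine ⟨((Set.finite_singleton PTree.leaf).union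
      (Set.Finite.image2 PTree.node ihT hB)).subset ?_, hB⟩
    rintro (_ | ⟨t, bs⟩) ⟨h, h'⟩
    · exact Or.inl rfl
    · have := bs.deg_card_pos
      rw [PTree.deg] at h h'
      simp only [Multiset.card_add, Multiset.mem_add] at h h'
      exact Or.inr ⟨t, ⟨by omega, fun y hy => h' y (Or.inl hy)⟩, bs,
        ⟨by omega, fun y hy => h' y (Or.inr hy)⟩, rfl⟩

theorem finite_deg_eq (d : Multiset X) : {t : PTree X | t.deg = d}.Finite := by
  refine ((finite_deg_le {x | x ∈ d} (Multiset.finite_toSet d) d.card).1).subset ?_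
  rintro t rfl
  exact ⟨le_rfl, fun x hx => hx⟩

end Degree

section Graded

variable {K : Type*} [CommRing K] {X : Type*} (q : K)

variable (K) in
/-- The submodule spanned by the basis elements of a given degree. -/
def homog {Y D : Type*} (deg : Y → D) (d : D) : Submodule K (Y →₀ K) :=
  Finsupp.supported K K {y | deg y = d}

theorem single_mem_homog {Y D : Type*} (deg : Y → D) (y : Y) :
    Finsupp.single y (1 : K) ∈ homog K deg (deg y) :=
  Finsupp.single_mem_supported K 1 rfl

theorem bilinear_mem_homog {Y Z W D : Type*} [Add D] {degY : Y → D} {degZ : Z → D} {degW : W → D}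
    {f : (Y →₀ K) →ₗ[K] (Z →₀ K) →ₗ[K] (W →₀ K)}
    (hf : ∀ y z, f (Finsupp.single y 1) (Finsupp.single z 1) ∈ homog K degW (degY y + degZ z))
    {d e : D} {a : Y →₀ K} {b : Z →₀ K} (ha : a ∈ homog K degY d) (hb : b ∈ homog K degZ e) :
    f a b ∈ homog K degW (d + e) := by
  rw [homog, Finsupp.supported_eq_span_single] at ha hb
  refine Submodule.span_induction₂ (p := fun a b _ _ => f a b ∈ homog K degW (d + e))
    ?_ ?_ ?_ ?_ ?_ ?_ ?_ ha hb
  · rintro _ _ ⟨y, rfl, rfl⟩ ⟨z, rfl, rfl⟩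
    exact hf y z
  · intro y _; rw [map_zero, LinearMap.zero_apply]; exact Submodule.zero_mem _
  · intro y _; rw [map_zero]; exact Submodule.zero_mem _
  · intro x y z _ _ _ h h'; rw [map_add, LinearMap.add_apply]; exact Submodule.add_mem _ h h'
  · intro x y z _ _ _ h h'; rw [map_add]; exact Submodule.add_mem _ h h'
  · intro r x y _ _ h; rw [map_smul, LinearMap.smul_apply]; exact Submodule.smul_mem _ _ h
  · intro r x y _ _ h; rw [map_smul]; exact Submodule.smul_mem _ _ h

theorem nodeL_mem_homog {a : Plus K X} {β : Branches X →₀ K} {d e : Multiset X}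
    (ha : a ∈ homog K PTree.deg d) (hβ : β ∈ homog K Branches.deg e) :
    nodeL a β ∈ homog K PTree.deg (d + e) := by
  refine bilinear_mem_homog (fun t bs => ?_) ha hβ
  rw [nodeL_single, ← PTree.deg]
  exact single_mem_homog _ _

theorem appendL_mem_homog {β γ : Branches X →₀ K} {d e : Multiset X}
    (hβ : β ∈ homog K Branches.deg d) (hγ : γ ∈ homog K Branches.deg e) :
    appendL β γ ∈ homog K Branches.deg (d + e) := by
  refine bilinear_mem_homog (fun bs cs => ?_) hβ hγ
  rw [appendL_single, ← Branches.deg_append]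
  exact single_mem_homog _ _

theorem singleL_mem_homog (x : X) {a : Plus K X} {d : Multiset X}
    (ha : a ∈ homog K PTree.deg d) : singleL x a ∈ homog K Branches.deg ({x} + d) := by
  rw [homog, Finsupp.supported_eq_span_single] at ha
  induction ha using Submodule.span_induction with
  | mem a ha =>
    obtain ⟨t, rfl, rfl⟩ := ha
    change singleL x (Finsupp.single t 1) ∈ _
    rw [singleL_single, ← Branches.deg]
    exact single_mem_homog _ _
  | zero => rw [map_zero]; exact Submodule.zero_mem _
  | add a b _ _ ha hb => rw [map_add]; exact Submodule.add_mem _ ha hb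
  | smul c a _ ha => rw [map_smul]; exact Submodule.smul_mem _ _ ha

mutual

theorem starProd_tree_mem_homog (t w : PTree X) :
    starProd q (Finsupp.single t 1) (Finsupp.single w 1) ∈ homog K PTree.deg (t.deg + w.deg) := by
  match t, w with
  | .leaf, w =>
    rw [← one, one_starProd, PTree.deg, zero_add]
    exact single_mem_homog _ _
  | .node t bs, .leaf =>
    rw [← one, starProd_one, PTree.deg.eq_1, add_zero]
    exact single_mem_homog _ _
  | .node t bs, .node w ws =>
    have h1 := starLast_tree_mem_homog bs (.node w ws)
    have h2 := starLast_tree_mem_homog bs w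
    have h3 := starProd_tree_mem_homog (.node t bs) w
    have ht := single_mem_homog (K := K) PTree.deg t
    have hws := single_mem_homog (K := K) Branches.deg ws
    simp only [← nodeL_single] at h1 h3 ⊢
    rw [starProd_nodeL, prec_nodeL, dot_nodeL, succ_nodeL]
    refine Submodule.add_mem _ (Submodule.add_mem _ ?_ (Submodule.smul_mem _ _ ?_)) ?_
    · have := nodeL_mem_homog ht h1
      rwa [← add_assoc, ← PTree.deg] at this
    · have := nodeL_mem_homog ht (appendL_mem_homog h2 hws)
      rwa [add_assoc bs.deg, ← PTree.deg, ← add_assoc, ← PTree.deg] at this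
    · have := nodeL_mem_homog h3 hws
      rwa [add_assoc, ← PTree.deg] at this
termination_by sizeOf t + sizeOf w

theorem starLast_tree_mem_homog (bs : Branches X) (w : PTree X) :
    starLast q (Finsupp.single bs 1) (Finsupp.single w 1) ∈
      homog K Branches.deg (bs.deg + w.deg) := by
  match bs with
  | .single x t =>
    have := singleL_mem_homog x (starProd_tree_mem_homog t w)
    rwa [← starLast_singleL, singleL_single, ← add_assoc, ← Branches.deg] at this
  | .cons x t bs =>
    have := appendL_mem_homog (singleL_mem_homog x (single_mem_homog (K := K) PTree.deg t))
      (starLast_tree_mem_homog bs w)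
    rwa [appendL_singleL, ← starLast_consL, consL_single, ← add_assoc, ← Branches.deg] at this
termination_by sizeOf bs + sizeOf w

end

theorem prec_mem_homog {a b : Plus K X} {d e : Multiset X} (ha : a ∈ homog K PTree.deg d)
    (hb : b ∈ homog K PTree.deg e) : prec q a b ∈ homog K PTree.deg (d + e) := by
  refine bilinear_mem_homog (fun t w => ?_) ha hb
  cases t with
  | leaf => rw [← one, one_prec]; exact Submodule.zero_mem _
  | node t bs =>
    rw [← nodeL_single, prec_nodeL, PTree.deg, add_assoc]
    exact nodeL_mem_homog (single_mem_homog _ _) (starLast_tree_mem_homog q _ _)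

theorem dot_mem_homog {a b : Plus K X} {d e : Multiset X} (ha : a ∈ homog K PTree.deg d)
    (hb : b ∈ homog K PTree.deg e) : dot q a b ∈ homog K PTree.deg (d + e) := by
  refine bilinear_mem_homog (fun t w => ?_) ha hb
  cases t with
  | leaf => rw [← one, one_dot]; exact Submodule.zero_mem _
  | node t bs =>
    cases w with
    | leaf => rw [← one, dot_one]; exact Submodule.zero_mem _
    | node w ws =>
      rw [← nodeL_single, ← nodeL_single, dot_nodeL, PTree.deg, PTree.deg, add_assoc,
        ← add_assoc bs.deg]
      exact nodeL_mem_homog (single_mem_homog _ _)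
        (appendL_mem_homog (starLast_tree_mem_homog q _ _) (single_mem_homog _ _))

theorem succ_mem_homog {a b : Plus K X} {d e : Multiset X} (ha : a ∈ homog K PTree.deg d)
    (hb : b ∈ homog K PTree.deg e) : succ q a b ∈ homog K PTree.deg (d + e) := by
  refine bilinear_mem_homog (fun t w => ?_) ha hb
  cases w with
  | leaf => rw [← one, succ_one]; exact Submodule.zero_mem _
  | node w ws =>
    rw [← nodeL_single, succ_nodeL, PTree.deg, ← add_assoc]
    exact nodeL_mem_homog (starProd_tree_mem_homog q _ _) (single_mem_homog _ _)

theorem succTilde_mem_homog {a b : Plus K X} {d e : Multiset X} (ha : a ∈ homog K PTree.deg d)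
    (hb : b ∈ homog K PTree.deg e) : succTilde q a b ∈ homog K PTree.deg (d + e) :=
  Submodule.add_mem _ (Submodule.smul_mem _ _ (dot_mem_homog q ha hb)) (succ_mem_homog q ha hb)

theorem one_mem_homog : (one : Plus K X) ∈ homog K PTree.deg 0 :=
  single_mem_homog PTree.deg PTree.leaf

theorem omegaPrec_mem_homog {l : List (Plus K X)} {ds : List (Multiset X)}
    (h : List.Forall₂ (fun y d => y ∈ homog K PTree.deg d) l ds) :
    omegaPrec q l ∈ homog K PTree.deg ds.sum := by
  induction h with
  | nil => exact one_mem_homog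
  | cons hy _ ih => rw [omegaPrec_cons, List.sum_cons]; exact prec_mem_homog q hy ih

theorem omegaSucc_mem_homog {l : List (Plus K X)} {ds : List (Multiset X)}
    (h : List.Forall₂ (fun y d => y ∈ homog K PTree.deg d) l ds) :
    omegaSucc q l ∈ homog K PTree.deg ds.sum := by
  suffices key : ∀ {a : Plus K X} {d : Multiset X}, a ∈ homog K PTree.deg d →
      l.foldl (fun a y => succTilde q a y) a ∈ homog K PTree.deg (d + ds.sum) by
    have := key one_mem_homog
    rwa [zero_add] at this
  induction h with
  | nil => intro a d ha; simpa using ha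
  | cons hy _ ih =>
    intro a d ha
    rw [List.foldl_cons, List.sum_cons, ← add_assoc]
    exact ih (succTilde_mem_homog q ha hy)

theorem braceOp_mem_homog {x : Plus K X} {d : Multiset X} (hx : x ∈ homog K PTree.deg d)
    {l : List (Plus K X)} {ds : List (Multiset X)}
    (h : List.Forall₂ (fun y d => y ∈ homog K PTree.deg d) l ds) :
    braceOp q x l ∈ homog K PTree.deg (d + ds.sum) := by
  refine Submodule.sum_mem _ fun i _ => Submodule.smul_mem _ _ ?_
  have := prec_mem_homog q (succTilde_mem_homog q (omegaPrec_mem_homog q (List.forall₂_take i h)) hx)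
    (omegaSucc_mem_homog q (List.forall₂_drop i h))
  rwa [add_right_comm, List.sum_take_add_sum_drop, add_comm] at this

end Graded

/-! ### The basis of primitive normal forms -/

section Basis

variable {K : Type*} [CommRing K] {X : Type*} (q : K)

/-- The primitive elements `gen x`. -/
def primGen (x : X) : Prim X q := ⟨Finsupp.single (PTree.gen x) 1, gen_mem_Prim x⟩

/-- The primitive elements given by the normal forms in the letters `gen x`. -/
abbrev primNF (bs : Branches X) : Prim X q := (primGV X q).normalForm (primGen q) bs

/-- The span of the normal forms. -/
abbrev primSpan : Submodule K (Prim X q) := Submodule.span K (Set.range (primNF (X := X) q))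

/-- The element `ω_≺(y₁, …, yₙ)` for the normal forms `y₁, …, yₙ` indexed by the lists of branches
at the vertices on the leftmost path of `t`. -/
abbrev omegaNF (t : PTree X) : Plus K X := primOmega q ((primGV X q).normalForms (primGen q) t)

/-- The span of the elements `ω_≺(y₁, …, yₙ)` for normal forms `y₁, …, yₙ`. -/
abbrev omegaSpan : Submodule K (Plus K X) := Submodule.span K (Set.range (omegaNF (X := X) q))

theorem isMultilinear_primOmega : IsMultilinear K (primOmega q : List (Prim X q) → Plus K X) := by
  intro c u y y' v
  have := isMultilinear_omegaPrec q c (u.map (↑)) (y : Plus K X) y' (v.map (↑))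
  simpa [primOmega] using this

variable {q}

theorem primOmega_mem_omegaSpan {l : List (Prim X q)} (hl : ∀ y ∈ l, y ∈ primSpan q) :
    primOmega q l ∈ omegaSpan (X := X) q := by
  refine (isMultilinear_primOmega q).mem_of_span (fun l hl => ?_) l hl
  obtain ⟨t, rfl⟩ := (primGV X q).exists_normalForms_eq (primGen q) hl
  exact Submodule.subset_span ⟨t, rfl⟩

theorem primNF_mem (bs : Branches X) : primNF q bs ∈ primSpan (X := X) q :=
  Submodule.subset_span ⟨bs, rfl⟩

theorem mem_of_mem_normalForms {t : PTree X} {y : Prim X q}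
    (hy : y ∈ (primGV X q).normalForms (primGen q) t) : y ∈ primSpan (X := X) q := by
  induction t using PTree.rec (motive_2 := fun _ => True) with
  | leaf => rw [GVAlgebra.normalForms] at hy; simp at hy
  | node t bs ht _ =>
    rw [GVAlgebra.normalForms] at hy
    rcases List.mem_cons.1 hy with rfl | hy
    · exact primNF_mem bs
    · exact ht hy
  | single => trivial
  | cons => trivial

theorem one_mem_omegaSpan : (one : Plus K X) ∈ omegaSpan (X := X) q := by
  rw [← primOmega_nil (q := q)]
  exact primOmega_mem_omegaSpan (by simp)

/-- An element of `omegaSpan` is a combination of `1` and elements `y ≺ ω_≺(l)`. -/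
@[elab_as_elim]
theorem omegaSpan_induction {P : Plus K X → Prop} {a : Plus K X} (ha : a ∈ omegaSpan (X := X) q)
    (hadd : ∀ a b, P a → P b → P (a + b)) (hsmul : ∀ (c : K) a, P a → P (c • a))
    (hone : P one)
    (hs : ∀ (y : Prim X q) (l : List (Prim X q)), y ∈ primSpan q → (∀ z ∈ l, z ∈ primSpan q) →
      P (prec q (y : Plus K X) (primOmega q l))) : P a := by
  induction ha using Submodule.span_induction with
  | mem a ha =>
    obtain ⟨t, rfl⟩ := ha
    cases t with
    | leaf => simpa [omegaNF, GVAlgebra.normalForms] using hone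
    | node t bs =>
      rw [omegaNF, GVAlgebra.normalForms, primOmega_cons]
      exact hs _ _ (primNF_mem bs) fun z hz => mem_of_mem_normalForms hz
  | zero => simpa using hsmul 0 one hone
  | add a b _ _ ha hb => exact hadd _ _ ha hb
  | smul c a _ ha => exact hsmul _ _ ha

theorem primBrace_mem {x : Prim X q} {l : List (Prim X q)} (hx : x ∈ primSpan (X := X) q)
    (hl : ∀ y ∈ l, y ∈ primSpan (X := X) q) : primBrace q x l ∈ primSpan (X := X) q :=
  (primGV X q).brace_mem_span_normalForm (primGen q) hx hl

theorem primMul_mem {x y : Prim X q} (hx : x ∈ primSpan (X := X) q)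
    (hy : y ∈ primSpan (X := X) q) : primMul q x y ∈ primSpan (X := X) q :=
  (primGV X q).mul_mem_span_normalForm (primGen q) hx hy

theorem prim_prec_mem {y : Prim X q} (hy : y ∈ primSpan (X := X) q) {a : Plus K X}
    (ha : a ∈ omegaSpan (X := X) q) : prec q (y : Plus K X) a ∈ omegaSpan (X := X) q := by
  induction ha using Submodule.span_induction with
  | mem a ha =>
    obtain ⟨t, rfl⟩ := ha
    rw [← primOmega_cons]
    refine primOmega_mem_omegaSpan fun z hz => ?_
    rcases List.mem_cons.1 hz with rfl | hz
    · exact hy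
    · exact mem_of_mem_normalForms hz
  | zero => rw [map_zero]; exact Submodule.zero_mem _
  | add a b _ _ ha hb => rw [map_add]; exact Submodule.add_mem _ ha hb
  | smul c a _ ha => rw [map_smul]; exact Submodule.smul_mem _ _ ha

theorem starProd_mem_omegaSpan {a b : Plus K X} (ha : a ∈ omegaSpan (X := X) q)
    (hb : b ∈ omegaSpan (X := X) q) : starProd q a b ∈ omegaSpan (X := X) q := by
  refine Submodule.span_induction₂ (p := fun a b _ _ => starProd q a b ∈ omegaSpan (X := X) q)
    ?_ ?_ ?_ ?_ ?_ ?_ ?_ ha hb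
  · rintro _ _ ⟨t, rfl⟩ ⟨w, rfl⟩
    rw [primOmega_starProd]
    exact braceWord_mem (W' := primSpan q) (fun l hl => primOmega_mem_omegaSpan hl)
      (fun y hy l hl => primBrace_mem (mem_of_mem_normalForms hy) hl)
      fun z hz => mem_of_mem_normalForms hz
  · intro y _; rw [map_zero, LinearMap.zero_apply]; exact Submodule.zero_mem _
  · intro y _; rw [map_zero]; exact Submodule.zero_mem _
  · intro x y z _ _ _ h h'; rw [map_add, LinearMap.add_apply]; exact Submodule.add_mem _ h h'
  · intro x y z _ _ _ h h'; rw [map_add]; exact Submodule.add_mem _ h h'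
  · intro r x y _ _ h; rw [map_smul, LinearMap.smul_apply]; exact Submodule.smul_mem _ _ h
  · intro r x y _ _ h; rw [map_smul]; exact Submodule.smul_mem _ _ h

theorem prec_mem_omegaSpan {a b : Plus K X} (ha : a ∈ omegaSpan (X := X) q)
    (hb : b ∈ omegaSpan (X := X) q) : prec q a b ∈ omegaSpan (X := X) q := by
  refine omegaSpan_induction ha ?_ ?_ ?_ ?_
  · intro x y h h'; rw [map_add, LinearMap.add_apply]; exact Submodule.add_mem _ h h'
  · intro r x h; rw [map_smul, LinearMap.smul_apply]; exact Submodule.smul_mem _ _ h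
  · rw [one_prec]; exact Submodule.zero_mem _
  · intro y l hy hl
    rw [prec_prec]
    exact prim_prec_mem hy (starProd_mem_omegaSpan (primOmega_mem_omegaSpan hl) hb)

theorem succTilde_prim_mem {y : Prim X q} (hy : y ∈ primSpan (X := X) q) {l : List (Prim X q)}
    (hl : ∀ z ∈ l, z ∈ primSpan (X := X) q) :
    succTilde q (primOmega q l) (y : Plus K X) ∈ omegaSpan (X := X) q := by
  rw [succTilde_primOmega]
  refine sumSplits_mem fun u v huv => prim_prec_mem (primBrace_mem hy fun z hz => hl z ?_)
    (primOmega_mem_omegaSpan fun z hz => hl z ?_)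
  · rw [← huv]; exact List.mem_append_left _ hz
  · rw [← huv]; exact List.mem_append_right _ hz

theorem prim_dot_mem {y : Prim X q} (hy : y ∈ primSpan (X := X) q) {a : Plus K X}
    (ha : a ∈ omegaSpan (X := X) q) : dot q (y : Plus K X) a ∈ omegaSpan (X := X) q := by
  refine omegaSpan_induction ha ?_ ?_ ?_ ?_
  · intro a b ha hb; rw [map_add]; exact Submodule.add_mem _ ha hb
  · intro c a ha; rw [map_smul]; exact Submodule.smul_mem _ _ ha
  · rw [dot_one]; exact Submodule.zero_mem _
  · intro z l hz hl
    rw [← dot_prec, ← coe_primMul]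
    exact prim_prec_mem (primMul_mem hy hz) (primOmega_mem_omegaSpan hl)

theorem succ_prim_mem {y : Prim X q} (hy : y ∈ primSpan (X := X) q) {l : List (Prim X q)}
    (hl : ∀ z ∈ l, z ∈ primSpan (X := X) q) :
    succ q (primOmega q l) (y : Plus K X) ∈ omegaSpan (X := X) q := by
  rw [succ_primOmega]
  refine sumSplits_mem fun u v huv => Submodule.smul_mem _ _ ?_
  have hu : ∀ z ∈ u, z ∈ primSpan (X := X) q := fun z hz =>
    hl z (by rw [← huv]; exact List.mem_append_left _ hz)
  have hv := succTilde_prim_mem hy fun z hz =>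
    hl z (by rw [← huv]; exact List.mem_append_right _ hz)
  clear huv
  induction u with
  | nil => exact hv
  | cons z u ih => exact prim_dot_mem (hu z (by simp)) (ih fun z hz => hu z (by simp [hz]))

theorem dot_mem_omegaSpan {a b : Plus K X} (ha : a ∈ omegaSpan (X := X) q)
    (hb : b ∈ omegaSpan (X := X) q) : dot q a b ∈ omegaSpan (X := X) q := by
  refine omegaSpan_induction ha ?_ ?_ ?_ ?_
  · intro x y h h'; rw [map_add, LinearMap.add_apply]; exact Submodule.add_mem _ h h'
  · intro r x h; rw [map_smul, LinearMap.smul_apply]; exact Submodule.smul_mem _ _ h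
  · rw [one_dot]; exact Submodule.zero_mem _
  intro y l hy hl
  refine omegaSpan_induction hb ?_ ?_ ?_ ?_
  · intro a b ha hb; rw [map_add]; exact Submodule.add_mem _ ha hb
  · intro c a ha; rw [map_smul]; exact Submodule.smul_mem _ _ ha
  · rw [dot_one]; exact Submodule.zero_mem _
  · intro z m hz hm
    rw [← dot_prec, prec_dot]
    exact prec_mem_omegaSpan (prim_dot_mem hy (succ_prim_mem hz hl)) (primOmega_mem_omegaSpan hm)

theorem succ_mem_omegaSpan {a b : Plus K X} (ha : a ∈ omegaSpan (X := X) q)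
    (hb : b ∈ omegaSpan (X := X) q) : succ q a b ∈ omegaSpan (X := X) q := by
  induction ha using Submodule.span_induction with
  | mem a ha =>
    obtain ⟨t, rfl⟩ := ha
    refine omegaSpan_induction hb ?_ ?_ ?_ ?_
    · intro a b ha hb; rw [map_add]; exact Submodule.add_mem _ ha hb
    · intro c a ha; rw [map_smul]; exact Submodule.smul_mem _ _ ha
    · rw [succ_one]; exact Submodule.zero_mem _
    · intro z m hz hm
      rw [← succ_prec]
      exact prec_mem_omegaSpan (succ_prim_mem hz fun z hz => mem_of_mem_normalForms hz)
        (primOmega_mem_omegaSpan hm)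
  | zero => rw [map_zero, LinearMap.zero_apply]; exact Submodule.zero_mem _
  | add a b _ _ ha hb => rw [map_add, LinearMap.add_apply]; exact Submodule.add_mem _ ha hb
  | smul c a _ ha => rw [map_smul, LinearMap.smul_apply]; exact Submodule.smul_mem _ _ ha

theorem gen_mem_omegaSpan (x : X) :
    nodeL one (singleL x one) ∈ omegaSpan (K := K) (X := X) q := by
  have h : nodeL one (singleL x one) = primOmega q [primGen q x] := by
    rw [primOmega_cons, primOmega_nil, prec_one q (counit_prim _)]
    change _ = (Finsupp.single (PTree.node .leaf (.single x .leaf)) 1 : Plus K X)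
    rw [← nodeL_single, ← singleL_single]
    rfl
  rw [h]
  refine primOmega_mem_omegaSpan fun y hy => ?_
  rw [List.mem_singleton.1 hy]
  have := primNF_mem (q := q) (Branches.single x PTree.leaf)
  rw [primNF, GVAlgebra.normalForm, GVAlgebra.normalForms, (primGV X q).brace_nil] at this
  exact this

/-- Every tree is obtained from `1` and the trees `gen x` by the three products. -/
theorem tree_mem_omegaSpan (t : PTree X) :
    (Finsupp.single t 1 : Plus K X) ∈ omegaSpan (X := X) q := by
  have hprec : ∀ (x : X) (a : Plus K X), prec q (nodeL one (singleL x one)) a =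
      nodeL one (singleL x a) := by
    intro x a; rw [prec_nodeL, starLast_singleL, one_starProd]
  induction t using PTree.rec (motive_2 := fun bs =>
    nodeL one (Finsupp.single bs 1) ∈ omegaSpan (K := K) (X := X) q) with
  | leaf => exact one_mem_omegaSpan
  | node t bs ht hbs =>
    have := succ_mem_omegaSpan ht hbs
    rwa [succ_nodeL, starProd_one, nodeL_single] at this
  | single x t ht =>
    rw [← singleL_single, ← hprec]
    exact prec_mem_omegaSpan (gen_mem_omegaSpan x) ht
  | cons x t bs ht hbs =>
    have := dot_mem_omegaSpan (prec_mem_omegaSpan (gen_mem_omegaSpan x) ht) hbs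
    rwa [hprec, dot_nodeL, starLast_singleL, starProd_one, appendL_singleL, consL_single] at this

variable (q) in
/-- The span of the elements `ω_≺(y₁, …, yₙ)` is closed under the three products and contains `1` and
the trees `gen x`, hence is everything. -/
theorem omegaSpan_eq_top : omegaSpan (K := K) (X := X) q = ⊤ := by
  rw [eq_top_iff]
  intro a _
  refine basis_induction a (Submodule.zero_mem _) (fun _ _ => Submodule.add_mem _)
    (fun c _ => Submodule.smul_mem _ c) tree_mem_omegaSpan

theorem primNF_mem_homog (bs : Branches X) :
    (primNF q bs : Plus K X) ∈ homog K PTree.deg bs.deg := by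
  have hgen : ∀ x : X, (primGen q x : Plus K X) ∈ homog K PTree.deg {x} := by
    intro x
    have := single_mem_homog (K := K) PTree.deg (PTree.gen x)
    rwa [PTree.gen, PTree.deg, Branches.deg, PTree.deg, zero_add, add_zero] at this
  have hbr : ∀ (x : X) {l : List (Prim X q)} {ds : List (Multiset X)},
      List.Forall₂ (fun (y : Prim X q) d => (y : Plus K X) ∈ homog K PTree.deg d) l ds →
      ((primGV X q).brace (primGen q x) l : Plus K X) ∈ homog K PTree.deg ({x} + ds.sum) := by
    intro x l ds h
    refine braceOp_mem_homog q (hgen x) ?_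
    rw [List.forall₂_map_left_iff]
    exact h
  induction bs using Branches.rec (motive_1 := fun t => ∃ ds : List (Multiset X),
    List.Forall₂ (fun (y : Prim X q) d => (y : Plus K X) ∈ homog K PTree.deg d)
      ((primGV X q).normalForms (primGen q) t) ds ∧ ds.sum = t.deg) with
  | leaf => rw [GVAlgebra.normalForms]; exact ⟨[], List.Forall₂.nil, by rw [PTree.deg]; rfl⟩
  | node t bs ht hbs =>
    obtain ⟨ds, h, hd⟩ := ht
    rw [GVAlgebra.normalForms]
    exact ⟨bs.deg :: ds, List.Forall₂.cons hbs h, by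
      rw [List.sum_cons, hd, PTree.deg, add_comm]⟩
  | single x t ht =>
    obtain ⟨ds, h, hd⟩ := ht
    rw [primNF, GVAlgebra.normalForm, Branches.deg, ← hd]
    exact hbr x h
  | cons x t bs ht hbs =>
    obtain ⟨ds, h, hd⟩ := ht
    rw [primNF, GVAlgebra.normalForm, Branches.deg, ← hd]
    exact dot_mem_homog q (hbr x h) hbs

theorem omegaNF_mem_homog (t : PTree X) : omegaNF q t ∈ homog K PTree.deg t.deg := by
  induction t using PTree.rec (motive_2 := fun _ => True) with
  | leaf => rw [omegaNF, GVAlgebra.normalForms, PTree.deg]; exact one_mem_homog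
  | node t bs ht _ =>
    rw [omegaNF, GVAlgebra.normalForms, primOmega_cons, PTree.deg, add_comm]
    exact prec_mem_homog q (primNF_mem_homog bs) ht
  | single => trivial
  | cons => trivial

variable (q)

/-- The elements `ω_≺(y₁, …, yₙ)` for normal forms `y₁, …, yₙ` are linearly independent: indexed by
trees, they are homogeneous of the same degrees as the trees, and they span. -/
theorem linearIndependent_omegaNF : LinearIndependent K (omegaNF (X := X) q) := by
  rw [LinearIndependent]
  refine injective_of_surjective_of_graded PTree.deg finite_deg_eq _ ?_ ?_
  · intro t t' h
    rw [Finsupp.linearCombination_single, one_smul] at h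
    have := omegaNF_mem_homog (q := q) t
    rw [homog, Finsupp.mem_supported] at this
    exact this (Finsupp.mem_support_iff.2 h)
  · rw [← LinearMap.range_eq_top, Finsupp.range_linearCombination]
    exact omegaSpan_eq_top q

/-- The lists of branches at the vertices on the leftmost path of a tree. -/
def PTree.branchList : PTree X → List (Branches X)
  | .leaf => []
  | .node t bs => bs :: t.branchList

variable (X) in
/-- The lists of branches at the vertices on the leftmost path of a tree determine the tree. -/
def PTree.listEquiv : List (Branches X) ≃ PTree X where
  toFun := PTree.ofList
  invFun := PTree.branchList
  left_inv l := by
    induction l with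
    | nil => rfl
    | cons b l ih => exact congrArg (b :: ·) ih
  right_inv t := by
    induction t using PTree.rec (motive_2 := fun _ => True) with
    | leaf => rfl
    | node t bs ht _ => exact congrArg (PTree.node · bs) ht
    | single => trivial
    | cons => trivial

/-- The basis of `Tridend_q(V)_+` formed by the elements `ω_≺(y₁, …, yₙ)` for normal forms
`y₁, …, yₙ`. -/
def omegaBasis : Module.Basis (List (Branches X)) K (Plus K X) :=
  (Module.Basis.mk (linearIndependent_omegaNF q) (omegaSpan_eq_top q).ge).reindex
    (PTree.listEquiv X).symm

theorem omegaBasis_apply (l : List (Branches X)) :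
    omegaBasis q l = primOmega q (l.map (primNF q)) := by
  rw [omegaBasis, Module.Basis.reindex_apply, Module.Basis.mk_apply, Equiv.symm_symm, omegaNF]
  exact congrArg (primOmega q) ((primGV X q).normalForms_ofList (primGen q) l)

theorem delta_omegaBasis (l : List (Branches X)) : delta q (omegaBasis q l) =
    sumSplits (fun u v => omegaBasis q v ⊗ₜ[K] omegaBasis q u) l := by
  simp only [omegaBasis_apply]
  rw [primOmega, List.map_map, delta_omegaPrec, sumSplits_map]
  · simp only [primOmega, List.map_map]
  · intro y hy
    obtain ⟨b, -, rfl⟩ := List.mem_map.1 hy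
    exact (primNF q b).2

theorem omegaBasis_nil : omegaBasis (X := X) q [] = one := by
  rw [omegaBasis_apply]; rfl

theorem omegaBasis_singleton (bs : Branches X) : omegaBasis q [bs] = primNF q bs := by
  rw [omegaBasis_apply, List.map_singleton, primOmega_cons, primOmega_nil,
    prec_one q (counit_prim _)]

/-- In the basis of the elements `ω_≺(y₁, …, yₙ)` the coproduct is deconcatenation, so that the
primitive elements are the combinations of the basis elements with `n = 1`. -/
theorem coord_eq_zero_of_mem_Prim {a : Plus K X} (ha : a ∈ Prim X q) {l : List (Branches X)}
    (hl : ∀ bs, l ≠ [bs]) : (omegaBasis q).coord l a = 0 := by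
  classical
  match l, hl with
  | [], _ =>
    have : (omegaBasis q).coord [] = counit (K := K) (X := X) := by
      refine (omegaBasis q).ext fun l => ?_
      cases l with
      | nil => rw [omegaBasis_nil, counit_one, ← omegaBasis_nil q]; simp
      | cons b l => rw [omegaBasis_apply q (b :: l), List.map_cons, primOmega_cons, counit_prec,
          ← primOmega_cons, ← List.map_cons, ← omegaBasis_apply]; simp
    rw [this, counit_of_mem_Prim ha]
  | [b], h => exact absurd rfl (h b)
  | b :: c :: v, _ =>
    -- the coordinate at `b :: c :: v` is the coefficient of `(c :: v) ⊗ [b]` in the coproduct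
    have key : (TensorProduct.lift ((LinearMap.mul K K).compl₁₂ ((omegaBasis q).coord (c :: v))
        ((omegaBasis q).coord [b]))) ∘ₗ delta q = (omegaBasis q).coord (b :: c :: v) := by
      refine (omegaBasis q).ext fun l => ?_
      rw [LinearMap.comp_apply, delta_omegaBasis, map_sumSplits]
      simp only [TensorProduct.lift.tmul, LinearMap.compl₁₂_apply, LinearMap.mul_apply',
        Module.Basis.coord_apply, Module.Basis.repr_self, Finsupp.single_apply]
      match l with
      | [] => simp [sumSplits]
      | [a] => simp [sumSplits]
      | a :: a' :: l =>
        simp only [sumSplits]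
        by_cases h : a = b <;> simp [h, sumSplits_zero]
    have h := LinearMap.congr_fun key a
    rw [LinearMap.comp_apply, mem_Prim.1 ha, ← omegaBasis_nil q] at h
    rw [← h]
    simp

/-- The normal forms are a basis of the space of primitive elements. -/
def primBasis : Module.Basis (Branches X) K (Prim X q) :=
  Module.Basis.mk (v := primNF q)
    (by
      refine LinearIndependent.of_comp (Prim X q).subtype ?_
      have : (Prim X q).subtype ∘ primNF q = omegaBasis q ∘ fun bs => [bs] := by
        funext bs
        exact (omegaBasis_singleton q bs).symm
      rw [this]
      exact (omegaBasis q).linearIndependent.comp _ fun a b h => by simpa using h)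
    (by
      rintro ⟨a, ha⟩ -
      have h : a ∈ Submodule.span K (omegaBasis q '' Set.range fun bs : Branches X => [bs]) := by
        rw [Module.Basis.mem_span_image]
        intro l hl
        by_contra hl'
        refine Finsupp.mem_support_iff.1 hl (coord_eq_zero_of_mem_Prim q ha fun bs h => ?_)
        exact hl' ⟨bs, h.symm⟩
      have h2 : omegaBasis q '' (Set.range fun bs : Branches X => [bs]) =
          (Prim X q).subtype '' Set.range (primNF q) := by
        rw [← Set.range_comp, ← Set.range_comp]
        congr 1
        funext bs
        exact omegaBasis_singleton q bs
      rw [h2, ← Submodule.map_span] at h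
      obtain ⟨y, hy, hya⟩ := h
      have : y = ⟨a, ha⟩ := Subtype.ext hya
      rwa [this] at hy)

theorem primBasis_apply (bs : Branches X) : primBasis q bs = primNF q bs := by
  rw [primBasis, Module.Basis.mk_apply]

end Basis

end Tridend
end

theorem mainTheorem2 {K : Type*} [Field K] (q : K) {V : Type*} [AddCommGroup V] [Module K V]
    {ι : Type*} (b : Module.Basis ι K V) :
    ∃ j : V →ₗ[K] Tridend.Prim ι q,
      (∀ i, (j (b i) : Tridend.Plus K ι) = Finsupp.single (Tridend.PTree.gen i) 1) ∧
      (∃ S : GVAlgebra q (Tridend.Prim ι q),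
        (∀ x y, (S.mul x y : Tridend.Plus K ι) = Tridend.dot q (x : Tridend.Plus K ι) y) ∧
        (∀ x (ys : List (Tridend.Prim ι q)), (S.brace x ys : Tridend.Plus K ι) =
          (-1 : K) ^ ys.length • Tridend.braceOp q (x : Tridend.Plus K ι) (ys.map (↑))) ∧
        GVAlgebra.IsFree.{w} S j) ∧
      (∃ S : GVAlgebra (-q) (Tridend.Prim ι q),
        (∀ x y, (S.mul x y : Tridend.Plus K ι) = Tridend.dot q (x : Tridend.Plus K ι) y) ∧
        (∀ x (ys : List (Tridend.Prim ι q)), (S.brace x ys : Tridend.Plus K ι) =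
          Tridend.braceOp q (x : Tridend.Plus K ι) (ys.map (↑))) ∧
        GVAlgebra.IsFree.{w} S j) := by
  have hfree := GVAlgebra.isFree_of_basis.{w} (S := Tridend.primGV ι q) (f := Tridend.primGen q) b
    (b.constr K (Tridend.primGen q)) (fun x => b.constr_basis K _ x) (Tridend.primBasis q)
    (Tridend.primBasis_apply q)
  refine ⟨b.constr K (Tridend.primGen q), fun i => ?_,
    ⟨(Tridend.primGV ι q).twist (neg_neg q).symm, fun _ _ => rfl, fun _ _ => rfl, hfree.twist _⟩,
    ⟨Tridend.primGV ι q, fun _ _ => rfl, fun _ _ => rfl, hfree⟩⟩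
  rw [b.constr_basis]
  rfl
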